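/- **Setting.** Let $M\ge 1$ and $[M]=\{1,\dots,M\}$. For each $A\subseteq[M]$ let $\mathsf P_A$ (expectation $\mathsf E_A$) be a probability measure under which the random elements $X_i(n)$, $i\in[M]$, $n\ge 1$, of a measurable space $\mathbb S$ are independent, each $X_i(n)$ having density $f_{1i}$ if $i\in A$ and $f_{0i}$ if $i\notin A$ with respect to a $\sigma$-finite measure $\nu_i$, and the randomization variables $Z_i(n)$, $i\in[M]$, $n\ge 0$, are independent, uniform on $(0,1)$, and independent of all the $X_i(n)$. Write $Z(n)=(Z_1(n),\dots,Z_M(n))$. Assume that $$I_i=\int\log\frac{f_{1i}}{f_{0i}}\,f_{1i}\,d\nu_i\in(0,\infty),\qquad J_i=\int\log\frac{f_{0i}}{f_{1i}}\,f_{0i}\,d\nu_i\in(0,\infty)\qquad\text{for all } i\in[M].$$ A *policy* $(R,T,\Delta)$ consists of random sets $R(n)\subseteq[M]$, $n\ge1$ (the sources sampled at time $n$), a random time $T\in\{1,2,\dots\}\cup\{\infty\}$ and a random set $\Delta\subseteq[M]$ (the sources declared anomalous upon stopping) such that, with $\mathcal F_0=\sigma(Z(0))$ and $\mathcal F_n=\sigma(\mathcal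 F_{n-1},Z(n),\{X_i(n): i\in R(n)\})$, for all $n\ge1$ and $D\subseteq[M]$, $R(n)$ is $\mathcal F_{n-1}$-measurable, $\{T=n\}\in\mathcal F_n$ and $\{T=n,\Delta=D\}\in\mathcal F_n$. For $k\in[M]$, $K\in(0,M]$ and $\alpha\in(0,1)$, let $\mathcal C(\alpha;k,K)$ be the class of policies with $$\frac1T\sum_{n=1}^T|R(n)|\le K \ \text{ on } \{T<\infty\},\ \mathsf P_A\text{-a.s.},\qquad \mathsf P_A\big(T<\infty,\ |A\triangle\Delta|\ge k\big)\le\alpha,\qquad\text{for all }A\subseteq[M],$$ and let $\mathcal J_A(\alpha;k,K)=\inf_{(R,T,\Delta)\in\mathcal C(\alpha;k,K)}\mathsf E_A[T]\in[1,\infty]$. Let $F_1(A)\le\dots\le F_M(A)$ be the numbers $I_i$ ($i\in A$) and $J_j$ ($j\notin A$) in increasing order, and let $$V(k,K,\boldsymbol F(A))=\max_{c\in[0,1]^M,\ \sum_i c_i\le K}\ \min_{U\subseteq[M],\ |U|=k}\ \sum_{i\in U}c_i\,F_i(A).$$ **Theorem.** Let $g_i=\log(f_{1i}/f_{0i})$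 and suppose that $$\sum_{i=1}^M\int|g_i|\log^+(|g_i|)\,f_{1i}\,d\nu_i<\infty,\qquad \sum_{i=1}^M\int|g_i|\log^+(|g_i|)\,f_{0i}\,d\nu_i<\infty.$$ Then for every $A\subseteq[M]$, $k\in[M]$ and $K\in(0,M]$, $$\liminf_{\alpha\to0^+}\ \frac{\mathcal J_A(\alpha;k,K)}{|\log\alpha|\,/\,V(k,K,\boldsymbol F(A))}\ \ge\ 1 .$$ -/

import Mathlib

open MeasureTheory ProbabilityTheory Filter Topology
open scoped ENNReal NNReal

namespace AnomalyId

/-- `M` independent data sources with values in `S`, observed on a common measurable space `Ω`.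
`P A` is the underlying probability measure when `A` is the set of anomalous sources.
`X i n` is the observation that source `i` generates at time `n + 1` (`n = 0, 1, 2, …`), and
`Z i n`, `n = 0, 1, 2, …`, are the uniform variables used for randomization at time `n`. -/
structure Model (M : ℕ) (S Ω : Type*) [MeasurableSpace S] [MeasurableSpace Ω] where
  /-- the dominating measures -/
  ν : Fin M → Measure S
  sigmaFinite_ν : ∀ i, SigmaFinite (ν i)
  /-- density of a non-anomalous source -/
  f₀ : Fin M → S → ℝ≥0
  /-- density of an anomalous source -/
  f₁ : Fin M → S → ℝ≥0
  measurable_f₀ : ∀ i, Measurable (f₀ i)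
  measurable_f₁ : ∀ i, Measurable (f₁ i)
  P : Finset (Fin M) → Measure Ω
  isProbabilityMeasure_P : ∀ A, IsProbabilityMeasure (P A)
  X : Fin M → ℕ → Ω → S
  Z : Fin M → ℕ → Ω → ℝ
  measurable_X : ∀ i n, Measurable (X i n)
  measurable_Z : ∀ i n, Measurable (Z i n)
  law_X : ∀ A i n, (P A).map (X i n) =
    (ν i).withDensity (fun x => if i ∈ A then (f₁ i x : ℝ≥0∞) else (f₀ i x : ℝ≥0∞))
  law_Z : ∀ A i n, (P A).map (Z i n) = (volume : Measure ℝ).restrict (Set.Ioo 0 1)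
  indep_X : ∀ A, iIndepFun (fun p : Fin M × ℕ => X p.1 p.2) (P A)
  indep_Z : ∀ A, iIndepFun (fun p : Fin M × ℕ => Z p.1 p.2) (P A)
  indep_XZ : ∀ A, IndepFun (fun ω (p : Fin M × ℕ) => X p.1 p.2 ω)
    (fun ω (p : Fin M × ℕ) => Z p.1 p.2 ω) (P A)

namespace Model

variable {M : ℕ} {S Ω : Type*} [MeasurableSpace S] [MeasurableSpace Ω] (m : Model M S Ω)

/-- The distribution of an observation of source `i` when it is not anomalous. -/
noncomputable def law₀ (i : Fin M) : Measure S := (m.ν i).withDensity (fun x => (m.f₀ i x : ℝ≥0∞))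

/-- The distribution of an observation of source `i` when it is anomalous. -/
noncomputable def law₁ (i : Fin M) : Measure S := (m.ν i).withDensity (fun x => (m.f₁ i x : ℝ≥0∞))

/-- The Kullback-Leibler divergence `I_i = ∫ log (f₁ᵢ / f₀ᵢ) f₁ᵢ dνᵢ`, with values in `[0, ∞]`. -/
noncomputable def klI (i : Fin M) : ℝ≥0∞ := InformationTheory.klDiv (m.law₁ i) (m.law₀ i)

/-- The Kullback-Leibler divergence `J_i = ∫ log (f₀ᵢ / f₁ᵢ) f₀ᵢ dνᵢ`, with values in `[0, ∞]`. -/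
noncomputable def klJ (i : Fin M) : ℝ≥0∞ := InformationTheory.klDiv (m.law₀ i) (m.law₁ i)

/-- All Kullback-Leibler numbers are positive and finite. -/
def KLPosFinite : Prop :=
  ∀ i, (0 < m.klI i ∧ m.klI i < ∞) ∧ (0 < m.klJ i ∧ m.klJ i < ∞)

/-- The log-likelihood ratio `g_i = log (f₁ᵢ / f₀ᵢ)` of one observation of source `i`. -/
noncomputable def g (i : Fin M) (x : S) : ℝ := Real.log ((m.f₁ i x : ℝ) / (m.f₀ i x : ℝ))

/-- The `L log L` moment condition on the log-likelihood ratios. -/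
def LLogLMoment : Prop :=
  (∑ i, ∫⁻ x, ENNReal.ofReal (|m.g i x| * Real.posLog |m.g i x|) * (m.f₁ i x : ℝ≥0∞) ∂(m.ν i) < ∞) ∧
  (∑ i, ∫⁻ x, ENNReal.ofReal (|m.g i x| * Real.posLog |m.g i x|) * (m.f₀ i x : ℝ≥0∞) ∂(m.ν i) < ∞)

/-- The information available at time `n` when the sources in `R m ω` are sampled at time `m + 1`:
`F_0 = σ(Z(0))` and `F_{n+1} = σ(F_n, Z(n+1), X_i(n+1) for the sources i sampled at time n+1)`.
An observation is available only on the event that its source is sampled. -/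
@[reducible] def info (R : ℕ → Ω → Finset (Fin M)) : ℕ → MeasurableSpace Ω
  | 0 => ⨆ i, MeasurableSpace.comap (m.Z i 0) inferInstance
  | n + 1 => info R n ⊔ (⨆ i, MeasurableSpace.comap (m.Z i (n + 1)) inferInstance) ⊔
      MeasurableSpace.generateFrom
        {E | ∃ (i : Fin M) (B : Set S), MeasurableSet B ∧ E = {ω | i ∈ R n ω ∧ X m i n ω ∈ B}}

/-- A policy: a sampling rule `R` (`R n` is the set of sources sampled at time `n + 1`, chosen on
the basis of the information at time `n`), a stopping rule `T` with values in `{1, 2, …, ∞}` and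
a decision rule `Δ`, the set of sources declared anomalous upon stopping.  The value of `Δ` is
irrelevant on the event that sampling never stops. -/
structure Policy where
  R : ℕ → Ω → Finset (Fin M)
  T : Ω → ℕ∞
  Δ : Ω → Finset (Fin M)
  sampling_rule : ∀ n D, MeasurableSet[m.info R n] {ω | R n ω = D}
  one_le_T : ∀ ω, 1 ≤ T ω
  stopping_rule : ∀ n : ℕ, MeasurableSet[m.info R n] {ω | T ω = n}
  decision_rule : ∀ (n : ℕ) (D : Finset (Fin M)), MeasurableSet[m.info R n] {ω | T ω = n ∧ Δ ω = D}

/-- The sampling constraint: the average number of observations, from all sources, until stopping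
is at most `K` (almost surely, whatever the set of anomalous sources). -/
def Policy.SamplingConstraint {m : Model M S Ω} (p : m.Policy) (K : ℝ) : Prop :=
  ∀ A, ∀ᵐ ω ∂(m.P A), ∀ t : ℕ, p.T ω = t →
    (∑ n ∈ Finset.range t, ((p.R n ω).card : ℝ)) / t ≤ K

/-- The generalized misclassification error constraint: whatever the set of anomalous sources,
the probability of stopping with at least `k` errors of any kind is at most `α`. -/
def Policy.ErrorConstraint {m : Model M S Ω} (p : m.Policy) (α : ℝ) (k : ℕ) : Prop :=
  ∀ A, m.P A {ω | p.T ω ≠ ⊤ ∧ k ≤ (symmDiff A (p.Δ ω)).card} ≤ ENNReal.ofReal α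

/-- The class of policies that satisfy both constraints. -/
def admissible (α : ℝ) (k : ℕ) (K : ℝ) : Set m.Policy :=
  {p | p.SamplingConstraint K ∧ p.ErrorConstraint α k}

/-- The smallest expected time for stopping among the admissible policies, when `A` is the set of
anomalous sources. -/
noncomputable def optimalTime (A : Finset (Fin M)) (α : ℝ) (k : ℕ) (K : ℝ) : ℝ≥0∞ :=
  ⨅ p ∈ m.admissible α k K, ∫⁻ ω, ((p.T ω : ℕ∞) : ℝ≥0∞) ∂(m.P A)

/-- The Kullback-Leibler number of source `i`: `I_i` if `i ∈ A`, and `J_i` otherwise. -/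
noncomputable def klNumber (A : Finset (Fin M)) (i : Fin M) : ℝ :=
  if i ∈ A then (m.klI i).toReal else (m.klJ i).toReal

/-- The ordered set `F(A)`: the numbers `I_i`, `i ∈ A`, and `J_j`, `j ∉ A`, in increasing order. -/
noncomputable def orderedKL (A : Finset (Fin M)) : Fin M → ℝ :=
  m.klNumber A ∘ Tuple.sort (m.klNumber A)

end Model

/-- The domain `{c ∈ [0,1]^M : ∑ c_i ≤ K}`. -/
def frequencyDomain (M : ℕ) (K : ℝ) : Set (Fin M → ℝ) :=
  {c | (∀ i, c i ∈ Set.Icc (0 : ℝ) 1) ∧ ∑ i, c i ≤ K}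

/-- The minimum of `∑_{i ∈ U} c_i L_i` over all sets `U` of `κ` indices. -/
noncomputable def minInfo {M : ℕ} (c : Fin M → ℝ) (κ : ℕ) (L : Fin M → ℝ) : ℝ :=
  ⨅ U : {U : Finset (Fin M) // U.card = κ}, ∑ i ∈ U.1, c i * L i

/-- The value `V(κ, K, L)` of the max-min problem: the maximum of `minInfo c κ L` over the
frequency domain. -/
noncomputable def maxMinValue {M : ℕ} (κ : ℕ) (K : ℝ) (L : Fin M → ℝ) : ℝ :=
  sSup ((fun c => minInfo c κ L) '' frequencyDomain M K)

end AnomalyId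

/-! Stopping early forces an ambiguity. If `T = n ≤ t`, the empirical sampling frequencies lie in
the frequency domain, so some `k`-set `U'` carries at most `V` units of information per unit of
time. Let `W` be the set of errors made under `A`, and flip the statuses in `U = U' \ W`. Against `A
∆ U` the same decision errs on `W ∪ U'`, that is, at least `k` times, while the log-likelihood ratio
of `A` against `A ∆ U` is at most about `V t` (`exists_errorAt_logLik_le`).

Under `P (A ∆ U)` such an error has probability at most `α`, so a change of measure
(`P_symmDiff_eq`) bounds the probability under `P A` of each such event by `e ^ a * α`, where `a` is
slightly larger than `V t`. The set `U` depends on the outcome, which costs a union over the `2 ^ M`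
subsets. For `t` just below `|log α| / V` the bound vanishes, hence `T > t` with probability near
one, and Markov's inequality concludes.

The phrase "about `V t`" rests on a weak law of large numbers for adaptively selected observations
(`selectedSum_ell_le`), uniform over selection rules and hence over policies. Integrability of the
log-likelihood ratio suffices: it is approximated in `L¹` by a simple function, whose centered
selected sums have orthogonal increments. -/

namespace AnomalyId

/-! ### Joins of σ-algebras, independence, and one-step extension of a likelihood ratio -/

section General

variable {Ω S : Type*} [MeasurableSpace S]

theorem generateFrom_inter_eq_sup (m₁ m₂ : MeasurableSpace Ω) :
    m₁ ⊔ m₂ = MeasurableSpace.generateFrom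
      {E | ∃ s t, MeasurableSet[m₁] s ∧ MeasurableSet[m₂] t ∧ E = s ∩ t} := by
  apply le_antisymm
  · refine sup_le (fun s hs => ?_) (fun t ht => ?_)
    · exact MeasurableSpace.measurableSet_generateFrom
        ⟨s, Set.univ, hs, MeasurableSet.univ, (Set.inter_univ s).symm⟩
    · exact MeasurableSpace.measurableSet_generateFrom
        ⟨Set.univ, t, MeasurableSet.univ, ht, (Set.univ_inter t).symm⟩
  · refine MeasurableSpace.generateFrom_le ?_
    rintro _ ⟨s, t, hs, ht, rfl⟩
    have h1 : MeasurableSet[m₁ ⊔ m₂] s := (le_sup_left : m₁ ≤ m₁ ⊔ m₂) s hs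
    have h2 : MeasurableSet[m₁ ⊔ m₂] t := (le_sup_right : m₂ ≤ m₁ ⊔ m₂) t ht
    exact h1.inter h2

theorem isPiSystem_inter (m₁ m₂ : MeasurableSpace Ω) :
    IsPiSystem {E | ∃ s t, MeasurableSet[m₁] s ∧ MeasurableSet[m₂] t ∧ E = s ∩ t} := by
  rintro _ ⟨s, t, hs, ht, rfl⟩ _ ⟨s', t', hs', ht', rfl⟩ -
  exact ⟨s ∩ s', t ∩ t', hs.inter hs', ht.inter ht', Set.inter_inter_inter_comm s t s' t'⟩

/-- Two finite measures that agree on intersections agree on the join of two σ-algebras. -/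
theorem measure_eq_of_sup {m₁ m₂ mΩ : MeasurableSpace Ω} (h₁ : m₁ ≤ mΩ) (h₂ : m₂ ≤ mΩ)
    {μ ν : Measure Ω} [IsFiniteMeasure μ]
    (h : ∀ s t, MeasurableSet[m₁] s → MeasurableSet[m₂] t → μ (s ∩ t) = ν (s ∩ t))
    {E : Set Ω} (hE : MeasurableSet[m₁ ⊔ m₂] E) : μ E = ν E := by
  have hle : m₁ ⊔ m₂ ≤ mΩ := sup_le h₁ h₂
  have key : μ.trim hle = ν.trim hle := by
    refine ext_of_generate_finite _ (generateFrom_inter_eq_sup m₁ m₂) (isPiSystem_inter m₁ m₂) ?_ ?_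
    · rintro _ ⟨s, t, hs, ht, rfl⟩
      have hst : MeasurableSet[m₁ ⊔ m₂] (s ∩ t) :=
        ((le_sup_left : m₁ ≤ m₁ ⊔ m₂) s hs).inter ((le_sup_right : m₂ ≤ m₁ ⊔ m₂) t ht)
      rw [trim_measurableSet_eq hle hst, trim_measurableSet_eq hle hst, h s t hs ht]
    · rw [trim_measurableSet_eq hle MeasurableSet.univ, trim_measurableSet_eq hle MeasurableSet.univ]
      simpa using h Set.univ Set.univ MeasurableSet.univ MeasurableSet.univ
  rw [← trim_measurableSet_eq hle hE, ← trim_measurableSet_eq hle hE, key]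

/-- On rectangles the probability factors in two stages, splitting off `m₂` and then `m₁`. -/
theorem indep_sup_of_indep {m₀ m₁ m₂ mΩ : MeasurableSpace Ω} (h₁ : m₁ ≤ mΩ)
    (h₂ : m₂ ≤ mΩ) {μ : Measure Ω} [IsProbabilityMeasure μ] (h : Indep m₀ m₁ μ)
    (h' : Indep (m₀ ⊔ m₁) m₂ μ) : Indep m₀ (m₁ ⊔ m₂) μ := by
  rw [Indep_iff] at h h' ⊢
  intro s E hs hE
  have hc : μ s ≠ ∞ := measure_ne_top μ s
  -- For fixed `s`, independence says that two finite measures agree on the join, so rectangles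
  -- suffice.
  have := measure_eq_of_sup h₁ h₂ (μ := μ.restrict s) (ν := μ s • μ) ?_ hE
  · rw [Measure.restrict_apply (sup_le h₁ h₂ E hE), Set.inter_comm] at this
    simpa using this
  · intro a b ha hb
    rw [Measure.restrict_apply ((h₁ a ha).inter (h₂ b hb))]
    have hs' : MeasurableSet[m₀ ⊔ m₁] s := (le_sup_left : m₀ ≤ m₀ ⊔ m₁) s hs
    have ha' : MeasurableSet[m₀ ⊔ m₁] a := (le_sup_right : m₁ ≤ m₀ ⊔ m₁) a ha
    have e : a ∩ b ∩ s = (s ∩ a) ∩ b := by ext; simp; tauto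
    rw [e, h' _ _ (hs'.inter ha') hb, h _ _ hs ha]
    simp only [Measure.smul_apply, smul_eq_mul]
    rw [h' _ _ ha' hb, mul_assoc]

/-- An observation seen only on `G` adds nothing off `G`, so each half of an event can be handled
with its own σ-algebra. -/
theorem measurable_decomposition {𝓕 : MeasurableSpace Ω} {Y : Ω → S} {G : Set Ω}
    (hG : MeasurableSet[𝓕] G) {E : Set Ω}
    (hE : MeasurableSet[𝓕 ⊔ MeasurableSpace.generateFrom
      {E | ∃ B : Set S, MeasurableSet B ∧ E = G ∩ Y ⁻¹' B}] E) :
    MeasurableSet[𝓕 ⊔ MeasurableSpace.comap Y inferInstance] (E ∩ G) ∧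
      MeasurableSet[𝓕] (E ∩ Gᶜ) := by
  set 𝓗 := 𝓕 ⊔ MeasurableSpace.comap Y inferInstance with h𝓗
  have hle : 𝓕 ≤ 𝓗 := le_sup_left
  have hG' : MeasurableSet[𝓗] G := hle G hG
  -- Good sets: the events that split as claimed form a σ-algebra containing the generators.
  let m' : MeasurableSpace Ω :=
    { MeasurableSet' := fun E => MeasurableSet[𝓗] (E ∩ G) ∧ MeasurableSet[𝓕] (E ∩ Gᶜ)
      measurableSet_empty := by simp
      measurableSet_compl := by
        rintro s ⟨h1, h2⟩
        constructor
        · have : sᶜ ∩ G = G \ (s ∩ G) := by ext; simp [and_comm]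
          rw [this]; exact hG'.diff h1
        · have : sᶜ ∩ Gᶜ = Gᶜ \ (s ∩ Gᶜ) := by ext; simp; tauto
          rw [this]; exact hG.compl.diff h2
      measurableSet_iUnion := by
        intro f hf
        rw [Set.iUnion_inter, Set.iUnion_inter]
        exact ⟨MeasurableSet.iUnion fun i => (hf i).1, MeasurableSet.iUnion fun i => (hf i).2⟩ }
  have hm' : 𝓕 ⊔ MeasurableSpace.generateFrom
      {E | ∃ B : Set S, MeasurableSet B ∧ E = G ∩ Y ⁻¹' B} ≤ m' := by
    refine sup_le (fun s hs => ?_) (MeasurableSpace.generateFrom_le ?_)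
    · exact ⟨(hle s hs).inter hG', hs.inter hG.compl⟩
    · rintro _ ⟨B, hB, rfl⟩
      constructor
      · have hY : MeasurableSet[𝓗] (Y ⁻¹' B) :=
          (le_sup_right : MeasurableSpace.comap Y inferInstance ≤ 𝓗) _ ⟨B, hB, rfl⟩
        exact (hG'.inter hY).inter hG'
      · have : G ∩ Y ⁻¹' B ∩ Gᶜ = ∅ := by ext; simp; tauto
        rw [this]; exact @MeasurableSet.empty Ω 𝓕
  exact hm' E hE

open Classical in
/-- Extension of a likelihood ratio by one observation that is available on the event `G` only. -/
theorem likelihood_step {𝓕 mΩ : MeasurableSpace Ω} {μ ν : Measure Ω} [IsProbabilityMeasure μ] [IsProbabilityMeasure ν]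
    (h𝓕 : 𝓕 ≤ mΩ) {L : Ω → ℝ≥0∞} (hL : Measurable[𝓕] L)
    (h : ∀ E, MeasurableSet[𝓕] E → ν E = ∫⁻ ω in E, L ω ∂μ)
    {Y : Ω → S} (hY : Measurable Y) {r : S → ℝ≥0∞} (hr : Measurable r)
    (hlaw : ν.map Y = (μ.map Y).withDensity r)
    (hμ : Indep 𝓕 (MeasurableSpace.comap Y inferInstance) μ)
    (hν : Indep 𝓕 (MeasurableSpace.comap Y inferInstance) ν)
    {G : Set Ω} (hG : MeasurableSet[𝓕] G) {E : Set Ω}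
    (hE : MeasurableSet[𝓕 ⊔ MeasurableSpace.generateFrom
      {E | ∃ B : Set S, MeasurableSet B ∧ E = G ∩ Y ⁻¹' B}] E) :
    ν E = ∫⁻ ω in E, L ω * (if ω ∈ G then r (Y ω) else 1) ∂μ := by
  have hYle : MeasurableSpace.comap Y inferInstance ≤ mΩ := hY.comap_le
  have hGm : MeasurableSet G := h𝓕 G hG
  have hEm : MeasurableSet E := by
    refine (sup_le h𝓕 (MeasurableSpace.generateFrom_le ?_) :
      𝓕 ⊔ MeasurableSpace.generateFrom _ ≤ mΩ) E hE
    rintro _ ⟨B, hB, rfl⟩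
    exact hGm.inter (hY hB)
  obtain ⟨hE1, hE2⟩ := measurable_decomposition hG hE
  have hLm : Measurable L := hL.mono h𝓕 le_rfl
  -- On `G` the observation is available, so both sides are compared on rectangles, where
  -- independence under `μ` and under `ν` applies. Off `G` the event is in `𝓕` and `h` applies
  -- directly.
  have part1 : ν (E ∩ G) = ∫⁻ ω in E ∩ G, L ω * r (Y ω) ∂μ := by
    have := measure_eq_of_sup h𝓕 hYle (μ := ν.restrict G)
      (ν := (μ.withDensity (fun ω => L ω * r (Y ω))).restrict G) ?_ hE1
    · have hm : MeasurableSet (E ∩ G) := hEm.inter hGm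
      rw [Measure.restrict_apply hm, Measure.restrict_apply hm, Set.inter_assoc, Set.inter_self,
        withDensity_apply _ hm] at this
      exact this
    · rintro s t hs ⟨B, hB, rfl⟩
      have hsm := h𝓕 s hs
      have hm : MeasurableSet (s ∩ Y ⁻¹' B ∩ G) := (hsm.inter (hY hB)).inter hGm
      rw [Measure.restrict_apply (hsm.inter (hY hB)), Measure.restrict_apply (hsm.inter (hY hB)),
        withDensity_apply _ hm]
      have e : s ∩ Y ⁻¹' B ∩ G = (s ∩ G) ∩ Y ⁻¹' B := by ext; simp; tauto
      rw [e, (Indep_iff _ _ _).1 hν (s ∩ G) (Y ⁻¹' B) (hs.inter hG) ⟨B, hB, rfl⟩,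
        h _ (hs.inter hG), ← Measure.map_apply hY hB, hlaw, withDensity_apply _ hB,
        setLIntegral_map hB hr hY, ← lintegral_indicator (hsm.inter hGm),
        ← lintegral_indicator (hY hB), ← lintegral_indicator ((hsm.inter hGm).inter (hY hB)),
        ← lintegral_mul_eq_lintegral_mul_lintegral_of_independent_measurableSpace h𝓕 hYle hμ]
      · refine lintegral_congr fun ω => ?_
        by_cases h1 : ω ∈ s ∩ G <;> by_cases h2 : ω ∈ Y ⁻¹' B <;>
          simp [Set.indicator, h1, h2]
      · exact hL.indicator (hs.inter hG)
      · exact Measurable.indicator (hr.comp (comap_measurable Y)) ⟨B, hB, rfl⟩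
  rw [← measure_inter_add_sdiff E hGm, ← lintegral_inter_add_sdiff _ E hGm, part1,
    Set.sdiff_eq, h _ hE2]
  congr 1
  · refine setLIntegral_congr_fun (hEm.inter hGm) fun ω hω => ?_
    simp [hω.2]
  · refine setLIntegral_congr_fun (hEm.inter hGm.compl) fun ω hω => ?_
    have : ω ∉ G := hω.2
    simp [this]

theorem comap_le_comap_pi {ι : Type*} (f : ι → Ω → S) (p : ι) :
    MeasurableSpace.comap (f p) inferInstance ≤
      MeasurableSpace.comap (fun ω (p : ι) => f p ω) inferInstance :=
  ((measurable_pi_apply p).comp (comap_measurable fun ω (p : ι) => f p ω)).comap_le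

end General

/-! ### Laws of the observations and their log-likelihood ratios -/

namespace Model

variable {M : ℕ} {S Ω : Type*} [MeasurableSpace S] [mΩ : MeasurableSpace Ω] (m : Model M S Ω)

instance (A : Finset (Fin M)) : IsProbabilityMeasure (m.P A) := m.isProbabilityMeasure_P A

/-- The law of an observation of source `i` when `A` is the set of anomalous sources. -/
noncomputable def law (A : Finset (Fin M)) (i : Fin M) : Measure S :=
  if i ∈ A then m.law₁ i else m.law₀ i

/-- The law of an observation of source `i` when the status of `i` is opposite to that in `A`. -/
noncomputable def altLaw (A : Finset (Fin M)) (i : Fin M) : Measure S :=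
  if i ∈ A then m.law₀ i else m.law₁ i

/-- The log-likelihood ratio of one observation of source `i`, for the actual status of `i`
in `A` against the opposite one. -/
noncomputable def ell (A : Finset (Fin M)) (i : Fin M) : S → ℝ := llr (m.law A i) (m.altLaw A i)

theorem map_X (A : Finset (Fin M)) (i : Fin M) (n : ℕ) : (m.P A).map (m.X i n) = m.law A i := by
  rw [m.law_X, law]
  split_ifs <;> rfl

theorem law_symmDiff (A U : Finset (Fin M)) (i : Fin M) :
    m.law (symmDiff A U) i = if i ∈ U then m.altLaw A i else m.law A i := by
  by_cases h1 : i ∈ A <;> by_cases h2 : i ∈ U <;>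
    simp [law, altLaw, h1, h2, Finset.mem_symmDiff]

instance (A : Finset (Fin M)) (i : Fin M) : IsProbabilityMeasure (m.law A i) := by
  rw [← m.map_X A i 0]
  exact Measure.isProbabilityMeasure_map (m.measurable_X i 0).aemeasurable

instance (A : Finset (Fin M)) (i : Fin M) : IsProbabilityMeasure (m.altLaw A i) := by
  have := m.law_symmDiff A {i} i
  simp only [Finset.mem_singleton, if_true] at this
  rw [← this]
  infer_instance

variable {m}

theorem klDiv_law_ne_top (hKL : m.KLPosFinite) (A : Finset (Fin M)) (i : Fin M) :
    InformationTheory.klDiv (m.law A i) (m.altLaw A i) ≠ ∞ := by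
  unfold law altLaw
  split_ifs
  · exact (hKL i).1.2.ne
  · exact (hKL i).2.2.ne

theorem law_ac_altLaw (hKL : m.KLPosFinite) (A : Finset (Fin M)) (i : Fin M) :
    m.law A i ≪ m.altLaw A i :=
  (InformationTheory.klDiv_ne_top_iff.1 (klDiv_law_ne_top hKL A i)).1

theorem altLaw_ac_law (hKL : m.KLPosFinite) (A : Finset (Fin M)) (i : Fin M) :
    m.altLaw A i ≪ m.law A i := by
  have h : InformationTheory.klDiv (m.altLaw A i) (m.law A i) ≠ ∞ := by
    unfold law altLaw
    split_ifs
    · exact (hKL i).2.2.ne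
    · exact (hKL i).1.2.ne
  exact (InformationTheory.klDiv_ne_top_iff.1 h).1

theorem integrable_ell (hKL : m.KLPosFinite) (A : Finset (Fin M)) (i : Fin M) :
    Integrable (m.ell A i) (m.law A i) :=
  (InformationTheory.klDiv_ne_top_iff.1 (klDiv_law_ne_top hKL A i)).2

theorem measurable_ell (A : Finset (Fin M)) (i : Fin M) : Measurable (m.ell A i) :=
  measurable_llr _ _

theorem integral_ell (hKL : m.KLPosFinite) (A : Finset (Fin M)) (i : Fin M) :
    ∫ x, m.ell A i x ∂(m.law A i) = m.klNumber A i := by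
  unfold ell
  rw [← InformationTheory.toReal_klDiv_of_measure_eq (law_ac_altLaw hKL A i) (by simp)]
  unfold klNumber klI klJ law altLaw
  split_ifs <;> rfl

theorem klNumber_pos (hKL : m.KLPosFinite) (A : Finset (Fin M)) (i : Fin M) :
    0 < m.klNumber A i := by
  unfold klNumber
  split_ifs
  · exact ENNReal.toReal_pos (hKL i).1.1.ne' (hKL i).1.2.ne
  · exact ENNReal.toReal_pos (hKL i).2.1.ne' (hKL i).2.2.ne

/-- Finiteness of both divergences makes the two laws mutually absolutely continuous, so the change
of measure has no singular part. -/
theorem withDensity_exp_neg_ell (hKL : m.KLPosFinite) (A : Finset (Fin M)) (i : Fin M) :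
    (m.law A i).withDensity (fun x => ENNReal.ofReal (Real.exp (-m.ell A i x))) = m.altLaw A i := by
  conv_rhs => rw [← Measure.withDensity_rnDeriv_eq _ _ (altLaw_ac_law hKL A i)]
  refine withDensity_congr_ae ?_
  filter_upwards [neg_llr (law_ac_altLaw hKL A i),
    exp_llr_of_ac' (m.altLaw A i) (m.law A i) (law_ac_altLaw hKL A i),
    Measure.rnDeriv_lt_top (m.altLaw A i) (m.law A i)] with x h1 h2 h3
  have h1' : -m.ell A i x = llr (m.altLaw A i) (m.law A i) x := h1
  rw [h1', h2, ENNReal.ofReal_toReal h3.ne]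

/-! ### Filtrations, independence and change of measure -/

variable (m)

/-- The information available at time `n` when all randomization variables are known from the
beginning. -/
@[reducible] def fullInfo (R : ℕ → Ω → Finset (Fin M)) : ℕ → MeasurableSpace Ω
  | 0 => ⨆ p : Fin M × ℕ, MeasurableSpace.comap (m.Z p.1 p.2) inferInstance
  | n + 1 => fullInfo R n ⊔ ⨆ i ∈ (Finset.univ : Finset (Fin M)), MeasurableSpace.generateFrom
        {E | ∃ B : Set S, MeasurableSet B ∧ E = {ω | i ∈ R n ω} ∩ m.X i n ⁻¹' B}

theorem fullInfo_le_succ (R : ℕ → Ω → Finset (Fin M)) (n : ℕ) :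
    m.fullInfo R n ≤ m.fullInfo R (n + 1) := le_sup_left

theorem fullInfo_mono (R : ℕ → Ω → Finset (Fin M)) : Monotone (m.fullInfo R) :=
  monotone_nat_of_le_succ (m.fullInfo_le_succ R)

/-- Enlarging the filtration keeps the events of a policy measurable, while each step of the
recursion now adds only observations. -/
theorem info_le_fullInfo (R : ℕ → Ω → Finset (Fin M)) (n : ℕ) :
    m.info R n ≤ m.fullInfo R n := by
  induction n with
  | zero =>
    exact iSup_le fun i => le_iSup (fun p : Fin M × ℕ =>
      MeasurableSpace.comap (m.Z p.1 p.2) inferInstance) (i, 0)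
  | succ n ih =>
    refine sup_le (sup_le (ih.trans (m.fullInfo_le_succ R n)) (iSup_le fun i => ?_))
      (MeasurableSpace.generateFrom_le ?_)
    · exact (le_iSup (fun p : Fin M × ℕ =>
        MeasurableSpace.comap (m.Z p.1 p.2) inferInstance) (i, n + 1)).trans
        (m.fullInfo_mono R (Nat.zero_le (n + 1)))
    · rintro _ ⟨i, B, hB, rfl⟩
      have h : MeasurableSpace.generateFrom
        {E | ∃ B : Set S, MeasurableSet B ∧ E = {ω | i ∈ R n ω} ∩ m.X i n ⁻¹' B} ≤
          m.fullInfo R (n + 1) :=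
        le_sup_of_le_right (le_iSup₂_of_le i (Finset.mem_univ i) le_rfl)
      exact h _ (MeasurableSpace.measurableSet_generateFrom ⟨B, hB, rfl⟩)

theorem measurableSet_mem {R : ℕ → Ω → Finset (Fin M)}
    (hR : ∀ n D, MeasurableSet[m.info R n] {ω | R n ω = D}) (n : ℕ) (i : Fin M) :
    MeasurableSet[m.fullInfo R n] {ω | i ∈ R n ω} := by
  have : {ω | i ∈ R n ω} = ⋃ D : {D : Finset (Fin M) // i ∈ D}, {ω | R n ω = D.1} := by
    ext ω; simp
  rw [this]
  exact MeasurableSet.iUnion fun D => m.info_le_fullInfo R n _ (hR n D.1)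

/-- The σ-algebra generated by all randomization variables and the observations with indices
in `Q`. -/
@[reducible] def dataInfo (Q : Set (Fin M × ℕ)) : MeasurableSpace Ω :=
  (⨆ p ∈ Q, MeasurableSpace.comap (m.X p.1 p.2) inferInstance) ⊔
    ⨆ p : Fin M × ℕ, MeasurableSpace.comap (m.Z p.1 p.2) inferInstance

theorem dataInfo_le (Q : Set (Fin M × ℕ)) : m.dataInfo Q ≤ mΩ :=
  sup_le (iSup₂_le fun p _ => (m.measurable_X p.1 p.2).comap_le)
    (iSup_le fun p => (m.measurable_Z p.1 p.2).comap_le)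

theorem dataInfo_mono {Q Q' : Set (Fin M × ℕ)} (h : Q ⊆ Q') : m.dataInfo Q ≤ m.dataInfo Q' :=
  sup_le_sup_right (biSup_mono h) _

theorem comap_X_le_dataInfo {Q : Set (Fin M × ℕ)} {p : Fin M × ℕ} (hp : p ∈ Q) :
    MeasurableSpace.comap (m.X p.1 p.2) inferInstance ≤ m.dataInfo Q :=
  le_sup_of_le_left (le_iSup₂_of_le p hp le_rfl)

/-- `X p` is independent of the other observations, and all observations jointly are independent of
the randomization; `indep_sup_of_indep` combines the two. -/
theorem indep_X_dataInfo (A : Finset (Fin M)) {Q : Set (Fin M × ℕ)} {p : Fin M × ℕ}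
    (hp : p ∉ Q) :
    Indep (MeasurableSpace.comap (m.X p.1 p.2) inferInstance) (m.dataInfo Q) (m.P A) := by
  have hX : iIndep (fun p : Fin M × ℕ => MeasurableSpace.comap (m.X p.1 p.2) inferInstance)
      (m.P A) := (m.indep_X A).iIndep
  have hle : ∀ p : Fin M × ℕ, MeasurableSpace.comap (m.X p.1 p.2) inferInstance ≤ mΩ :=
    fun p => (m.measurable_X p.1 p.2).comap_le
  have hQ : Indep (MeasurableSpace.comap (m.X p.1 p.2) inferInstance)
      (⨆ p ∈ Q, MeasurableSpace.comap (m.X p.1 p.2) inferInstance) (m.P A) := by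
    have := indep_iSup_of_disjoint hle hX (Set.disjoint_singleton_left.2 hp)
    rwa [iSup_singleton] at this
  have hZ := (IndepFun_iff_Indep _ _ _).1 (m.indep_XZ A)
  have key := comap_le_comap_pi (fun p : Fin M × ℕ => m.X p.1 p.2)
  have h1 : (⨆ p ∈ Q, MeasurableSpace.comap (m.X p.1 p.2) inferInstance) ≤ mΩ :=
    iSup₂_le fun p _ => hle p
  have h2 : (⨆ p : Fin M × ℕ, MeasurableSpace.comap (m.Z p.1 p.2) inferInstance) ≤ mΩ :=
    iSup_le fun p => (m.measurable_Z p.1 p.2).comap_le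
  have h3 : (⨆ p : Fin M × ℕ, MeasurableSpace.comap (m.Z p.1 p.2) inferInstance) ≤
      MeasurableSpace.comap (fun ω (p : Fin M × ℕ) => m.Z p.1 p.2 ω) inferInstance :=
    iSup_le fun p => comap_le_comap_pi (fun p : Fin M × ℕ => m.Z p.1 p.2) p
  have h4 : MeasurableSpace.comap (m.X p.1 p.2) inferInstance ⊔
      (⨆ p ∈ Q, MeasurableSpace.comap (m.X p.1 p.2) inferInstance) ≤
      MeasurableSpace.comap (fun ω (p : Fin M × ℕ) => m.X p.1 p.2 ω) inferInstance :=
    sup_le (key p) (iSup₂_le fun q _ => key q)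
  have h5 := indep_of_indep_of_le_left (indep_of_indep_of_le_right hZ h3) h4
  exact indep_sup_of_indep h1 h2 hQ h5

/-- `fullInfo` at time `n` together with the observations at time `n + 1` from the sampled sources
in `s`. -/
@[reducible] def partialInfo (R : ℕ → Ω → Finset (Fin M)) (n : ℕ) (s : Finset (Fin M)) :
    MeasurableSpace Ω :=
  m.fullInfo R n ⊔ ⨆ i ∈ s, MeasurableSpace.generateFrom
        {E | ∃ B : Set S, MeasurableSet B ∧ E = {ω | i ∈ R n ω} ∩ m.X i n ⁻¹' B}

theorem partialInfo_le_dataInfo_of {R : ℕ → Ω → Finset (Fin M)}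
    (hR : ∀ n D, MeasurableSet[m.info R n] {ω | R n ω = D}) {n : ℕ} {s : Finset (Fin M)}
    {Q : Set (Fin M × ℕ)} (h : m.fullInfo R n ≤ m.dataInfo Q) (hs : ∀ i ∈ s, (i, n) ∈ Q) :
    m.partialInfo R n s ≤ m.dataInfo Q := by
  refine sup_le h (iSup₂_le fun i hi => MeasurableSpace.generateFrom_le ?_)
  rintro _ ⟨B, hB, rfl⟩
  have h1 : MeasurableSet[m.dataInfo Q] {ω | i ∈ R n ω} := h _ (m.measurableSet_mem hR n i)
  have h2 : MeasurableSet[m.dataInfo Q] (m.X i n ⁻¹' B) :=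
    m.comap_X_le_dataInfo (hs i hi) _ ⟨B, hB, rfl⟩
  exact h1.inter h2

theorem fullInfo_le_dataInfo {R : ℕ → Ω → Finset (Fin M)}
    (hR : ∀ n D, MeasurableSet[m.info R n] {ω | R n ω = D}) (n : ℕ) :
    m.fullInfo R n ≤ m.dataInfo {q | q.2 < n} := by
  induction n with
  | zero => exact le_sup_right
  | succ n ih =>
    refine m.partialInfo_le_dataInfo_of hR
      (ih.trans (m.dataInfo_mono fun q (hq : q.2 < n) => hq.trans n.lt_succ_self)) ?_
    intro i _
    exact n.lt_succ_self

theorem partialInfo_le_dataInfo {R : ℕ → Ω → Finset (Fin M)}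
    (hR : ∀ n D, MeasurableSet[m.info R n] {ω | R n ω = D}) {n : ℕ} {s : Finset (Fin M)} {i : Fin M}
    (hi : i ∉ s) : m.partialInfo R n s ≤ m.dataInfo {q | q ≠ (i, n)} := by
  refine m.partialInfo_le_dataInfo_of hR
    ((m.fullInfo_le_dataInfo hR n).trans (m.dataInfo_mono ?_)) ?_
  · rintro q (hq : q.2 < n) rfl
    exact lt_irrefl _ hq
  · rintro j hj h
    have : j = i := congrArg Prod.fst h
    exact hi (this ▸ hj)

theorem fullInfo_le {R : ℕ → Ω → Finset (Fin M)}
    (hR : ∀ n D, MeasurableSet[m.info R n] {ω | R n ω = D}) (n : ℕ) : m.fullInfo R n ≤ mΩ :=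
  (m.fullInfo_le_dataInfo hR n).trans (m.dataInfo_le _)

theorem indep_partialInfo (A : Finset (Fin M)) {R : ℕ → Ω → Finset (Fin M)}
    (hR : ∀ n D, MeasurableSet[m.info R n] {ω | R n ω = D}) {n : ℕ} {s : Finset (Fin M)} {i : Fin M}
    (hi : i ∉ s) :
    Indep (m.partialInfo R n s) (MeasurableSpace.comap (m.X i n) inferInstance) (m.P A) :=
  indep_of_indep_of_le_left (m.indep_X_dataInfo A (p := (i, n)) (Q := {q | q ≠ (i, n)})
    (by simp)).symm (m.partialInfo_le_dataInfo hR hi)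

/-- The randomization variables have the same product law under every `P A`. This is the base case
of the change of measure. -/
theorem P_eq_of_fullInfo_zero (A B : Finset (Fin M)) (R : ℕ → Ω → Finset (Fin M)) {E : Set Ω}
    (hE : MeasurableSet[m.fullInfo R 0] E) : m.P A E = m.P B E := by
  have hle : m.fullInfo R 0 ≤
      MeasurableSpace.comap (fun ω (p : Fin M × ℕ) => m.Z p.1 p.2 ω) inferInstance :=
    iSup_le fun p => comap_le_comap_pi (fun p : Fin M × ℕ => m.Z p.1 p.2) p
  have hm : ∀ p : Fin M × ℕ, Measurable (m.Z p.1 p.2) := fun p => m.measurable_Z p.1 p.2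
  have hmap : ∀ A, (m.P A).map (fun ω (p : Fin M × ℕ) => m.Z p.1 p.2 ω) =
      Measure.infinitePi fun _ : Fin M × ℕ => (volume : Measure ℝ).restrict (Set.Ioo 0 1) := by
    intro A
    rw [(iIndepFun_iff_map_fun_eq_infinitePi_map hm).1 (m.indep_Z A)]
    simp only [m.law_Z]
  obtain ⟨C, hC, rfl⟩ := hle E hE
  have hmZ : Measurable (fun ω (p : Fin M × ℕ) => m.Z p.1 p.2 ω) := measurable_pi_lambda _ hm
  rw [← Measure.map_apply hmZ hC, ← Measure.map_apply hmZ hC, hmap, hmap]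

/-- The likelihood ratio, at time `n`, of the sampled observations from sources in `U`,
for the statuses opposite to those in `A` against those in `A`. -/
noncomputable def likelihood (A U : Finset (Fin M)) (R : ℕ → Ω → Finset (Fin M)) (n : ℕ) (ω : Ω) :
    ℝ≥0∞ :=
  ∏ s ∈ Finset.range n, ∏ i, if i ∈ R s ω then
    (if i ∈ U then ENNReal.ofReal (Real.exp (-m.ell A i (m.X i s ω))) else 1) else 1

theorem measurable_factor (A U : Finset (Fin M)) {R : ℕ → Ω → Finset (Fin M)}
    (hR : ∀ n D, MeasurableSet[m.info R n] {ω | R n ω = D}) (n : ℕ) {s : Finset (Fin M)}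
    {i : Fin M} (hi : i ∈ s) :
    Measurable[m.partialInfo R n s] fun ω => if i ∈ R n ω then
      (if i ∈ U then ENNReal.ofReal (Real.exp (-m.ell A i (m.X i n ω))) else 1) else 1 := by
  by_cases hU : i ∈ U
  · simp only [hU, if_true]
    have hle : MeasurableSpace.generateFrom
        {E | ∃ B : Set S, MeasurableSet B ∧ E = {ω | i ∈ R n ω} ∩ m.X i n ⁻¹' B} ≤
        m.partialInfo R n s := le_sup_of_le_right (le_iSup₂_of_le i hi le_rfl)
    have hw : Measurable fun x => ENNReal.ofReal (Real.exp (-m.ell A i x)) :=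
      ENNReal.measurable_ofReal.comp (Real.measurable_exp.comp (measurable_ell A i).neg)
    have hG : MeasurableSet[m.partialInfo R n s] {ω | i ∈ R n ω} :=
      (le_sup_left : m.fullInfo R n ≤ m.partialInfo R n s) _ (m.measurableSet_mem hR n i)
    intro C hC
    have e : (fun ω => if i ∈ R n ω then
        ENNReal.ofReal (Real.exp (-m.ell A i (m.X i n ω))) else 1) ⁻¹' C =
        ({ω | i ∈ R n ω} ∩ m.X i n ⁻¹'
          ((fun x => ENNReal.ofReal (Real.exp (-m.ell A i x))) ⁻¹' C)) ∪
        ({ω | i ∈ R n ω}ᶜ ∩ {_ω | (1 : ℝ≥0∞) ∈ C}) := by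
      ext ω
      by_cases h : i ∈ R n ω <;> simp [h]
    rw [e]
    refine MeasurableSet.union (hle _ (MeasurableSpace.measurableSet_generateFrom
      ⟨_, hw hC, rfl⟩)) (hG.compl.inter (MeasurableSet.const _))
  · simp only [hU, if_false, ite_self]
    exact measurable_const

theorem measurable_likelihood (A U : Finset (Fin M)) {R : ℕ → Ω → Finset (Fin M)}
    (hR : ∀ n D, MeasurableSet[m.info R n] {ω | R n ω = D}) (n : ℕ) :
    Measurable[m.fullInfo R n] (m.likelihood A U R n) := by
  unfold likelihood
  refine Finset.measurable_prod _ fun s hs => Finset.measurable_prod _ fun i _ => ?_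
  refine (m.measurable_factor A U hR s (Finset.mem_univ i)).mono ?_ le_rfl
  exact m.fullInfo_mono R (Nat.succ_le_of_lt (Finset.mem_range.1 hs))

/-- Change of measure: the likelihood ratio of the sampled observations is the density of
`P (A ∆ U)` with respect to `P A` on the available information. -/
theorem P_symmDiff_eq (hKL : m.KLPosFinite) (A U : Finset (Fin M)) {R : ℕ → Ω → Finset (Fin M)}
    (hR : ∀ n D, MeasurableSet[m.info R n] {ω | R n ω = D}) (n : ℕ) {E : Set Ω}
    (hE : MeasurableSet[m.fullInfo R n] E) :
    m.P (symmDiff A U) E = ∫⁻ ω in E, m.likelihood A U R n ω ∂(m.P A) := by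
  classical
  induction n generalizing E with
  | zero => simpa [likelihood] using m.P_eq_of_fullInfo_zero (symmDiff A U) A R hE
  | succ n ih =>
    -- The observations of one time step are revealed source by source, so that each extension is a
    -- single application of `likelihood_step`.
    have key : ∀ s : Finset (Fin M), ∀ E, MeasurableSet[m.partialInfo R n s] E →
        m.P (symmDiff A U) E = ∫⁻ ω in E, m.likelihood A U R n ω * ∏ i ∈ s, (if i ∈ R n ω then
          (if i ∈ U then ENNReal.ofReal (Real.exp (-m.ell A i (m.X i n ω))) else 1) else 1)
            ∂(m.P A) := by
      intro s
      induction s using Finset.induction_on with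
      | empty =>
        intro E hE
        simp only [Finset.prod_empty, mul_one]
        have e : m.partialInfo R n ∅ = m.fullInfo R n := by simp [partialInfo]
        rw [e] at hE
        exact ih hE
      | insert a s ha ihs =>
        intro E hE
        have hle : m.partialInfo R n s ≤ mΩ := (m.partialInfo_le_dataInfo hR ha).trans
          (m.dataInfo_le _)
        have hw : Measurable fun x => if a ∈ U then
            ENNReal.ofReal (Real.exp (-m.ell A a x)) else 1 := by
          split_ifs
          · exact ENNReal.measurable_ofReal.comp (Real.measurable_exp.comp (measurable_ell A a).neg)
          · exact measurable_const
        have hL : Measurable[m.partialInfo R n s] fun ω => m.likelihood A U R n ω *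
            ∏ i ∈ s, (if i ∈ R n ω then (if i ∈ U then
              ENNReal.ofReal (Real.exp (-m.ell A i (m.X i n ω))) else 1) else 1) :=
          ((m.measurable_likelihood A U hR n).mono le_sup_left le_rfl).mul
            (Finset.measurable_prod _ fun i hi => m.measurable_factor A U hR n hi)
        have hlaw : (m.P (symmDiff A U)).map (m.X a n) = ((m.P A).map (m.X a n)).withDensity
            (fun x => if a ∈ U then ENNReal.ofReal (Real.exp (-m.ell A a x)) else 1) := by
          rw [m.map_X, m.map_X, law_symmDiff]
          split_ifs
          · exact (withDensity_exp_neg_ell hKL A a).symm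
          · exact (withDensity_one).symm
        have hG : MeasurableSet[m.partialInfo R n s] {ω | a ∈ R n ω} :=
          (le_sup_left : m.fullInfo R n ≤ m.partialInfo R n s) _ (m.measurableSet_mem hR n a)
        have hE' : MeasurableSet[m.partialInfo R n s ⊔ MeasurableSpace.generateFrom
            {E | ∃ B : Set S, MeasurableSet B ∧ E = {ω | a ∈ R n ω} ∩ m.X a n ⁻¹' B}] E := by
          have e : m.partialInfo R n (insert a s) = m.partialInfo R n s ⊔
              MeasurableSpace.generateFrom
              {E | ∃ B : Set S, MeasurableSet B ∧ E = {ω | a ∈ R n ω} ∩ m.X a n ⁻¹' B} := by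
            unfold partialInfo
            rw [Finset.iSup_insert, sup_comm (MeasurableSpace.generateFrom _), sup_assoc]
          rw [← e]
          exact hE
        rw [likelihood_step hle hL ihs (m.measurable_X a n) hw hlaw (m.indep_partialInfo A hR ha)
          (m.indep_partialInfo _ hR ha) hG hE']
        refine lintegral_congr fun ω => ?_
        rw [Finset.prod_insert ha, mul_assoc, mul_comm (Finset.prod _ _)]
        congr!
    rw [key Finset.univ E hE]
    refine lintegral_congr fun ω => ?_
    rw [likelihood, likelihood, Finset.prod_range_succ]

/-! ### A uniform weak law for selected observations -/

/-- All data up to and including time `n`, and all randomization variables. -/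
@[reducible] def past (n : ℕ) : MeasurableSpace Ω := m.dataInfo {q | q.2 < n}

theorem past_le (n : ℕ) : m.past n ≤ mΩ := m.dataInfo_le _

theorem past_mono : Monotone m.past := fun _ _ h =>
  m.dataInfo_mono fun _ hq => lt_of_lt_of_le hq h

/-- The sum up to time `t` of the values `h (X_i)` over the times that belong to `G`. -/
noncomputable def selectedSum (i : Fin M) (h : S → ℝ) (G : ℕ → Set Ω) (t : ℕ) (ω : Ω) : ℝ :=
  ∑ s ∈ Finset.range t, (G s).indicator (fun ω => h (m.X i s ω)) ω

theorem measurable_selectedSum {i : Fin M} {h : S → ℝ} (hh : Measurable h) {G : ℕ → Set Ω}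
    (hG : ∀ n, MeasurableSet[m.past n] (G n)) (t : ℕ) :
    Measurable[m.past t] (m.selectedSum i h G t) := by
  unfold selectedSum
  refine Finset.measurable_sum _ fun s hs => ?_
  have hst := Finset.mem_range.1 hs
  refine Measurable.indicator ?_ (m.past_mono hst.le _ (hG s))
  refine hh.comp ?_
  exact (comap_measurable (m.X i s)).mono
    (m.comap_X_le_dataInfo (p := (i, s)) (Q := {q | q.2 < t}) hst) le_rfl

theorem abs_selectedSum_le {i : Fin M} {h : S → ℝ} {C : ℝ} (hC : ∀ x, |h x| ≤ C)
    (G : ℕ → Set Ω) (t : ℕ) (ω : Ω) : |m.selectedSum i h G t ω| ≤ t * C := by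
  unfold selectedSum
  refine (Finset.abs_sum_le_sum_abs _ _).trans ?_
  have : ∀ s ∈ Finset.range t, |(G s).indicator (fun ω => h (m.X i s ω)) ω| ≤ C := by
    intro s _
    by_cases hω : ω ∈ G s
    · simpa [hω] using hC _
    · simpa [hω] using (abs_nonneg _).trans (hC (m.X i s ω))
  simpa using Finset.sum_le_card_nsmul _ _ _ this

theorem integral_comp_X (A : Finset (Fin M)) (i : Fin M) (n : ℕ) {h : S → ℝ} (hh : Measurable h) :
    ∫ ω, h (m.X i n ω) ∂(m.P A) = ∫ x, h x ∂(m.law A i) := by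
  rw [← m.map_X A i n, integral_map (m.measurable_X i n).aemeasurable hh.aestronglyMeasurable]

/-- Orthogonality of the increments of a sum of centered bounded functions of the observations. -/
theorem integral_selectedSum_sq_le (A : Finset (Fin M)) {i : Fin M} {h : S → ℝ} (hh : Measurable h)
    {C : ℝ} (hC : ∀ x, |h x| ≤ C) (h0 : ∫ x, h x ∂(m.law A i) = 0) {G : ℕ → Set Ω}
    (hG : ∀ n, MeasurableSet[m.past n] (G n)) (t : ℕ) :
    ∫ ω, (m.selectedSum i h G t ω) ^ 2 ∂(m.P A) ≤ t * C ^ 2 := by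
  induction t with
  | zero => simp [selectedSum]
  | succ t ih =>
    set T := m.selectedSum i h G t with hT
    have hTm : Measurable[m.past t] T := m.measurable_selectedSum hh hG t
    have hTm' : Measurable T := hTm.mono (m.past_le t) le_rfl
    have hGm : MeasurableSet (G t) := m.past_le t _ (hG t)
    have hXm : Measurable fun ω => h (m.X i t ω) := hh.comp (m.measurable_X i t)
    have hW : Measurable[m.past t] ((G t).indicator fun ω => 2 * T ω) :=
      Measurable.indicator (hTm.const_mul 2) (hG t)
    have e : ∀ ω, (m.selectedSum i h G (t + 1) ω) ^ 2 = (T ω) ^ 2 +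
        ((G t).indicator (fun ω => 2 * T ω) * fun ω => h (m.X i t ω)) ω +
        (G t).indicator (fun ω => h (m.X i t ω) ^ 2) ω := by
      intro ω
      have : m.selectedSum i h G (t + 1) ω = T ω + (G t).indicator (fun ω => h (m.X i t ω)) ω := by
        rw [hT, selectedSum, Finset.sum_range_succ, selectedSum]
      rw [this]
      by_cases hω : ω ∈ G t
      · simp [hω]; ring
      · simp [hω]
    have hCnn : ∀ ω, |h (m.X i t ω)| ≤ C := fun ω => hC _
    have hTb : ∀ ω, |T ω| ≤ t * C := m.abs_selectedSum_le hC G t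
    have i1 : Integrable (fun ω => (T ω) ^ 2) (m.P A) := by
      refine Integrable.of_bound (hTm'.pow_const 2).aestronglyMeasurable ((t * C) ^ 2)
        (ae_of_all _ fun ω => ?_)
      rw [Real.norm_eq_abs, abs_pow]
      exact pow_le_pow_left₀ (abs_nonneg _) (hTb ω) 2
    have i2 : Integrable ((G t).indicator (fun ω => 2 * T ω) * fun ω => h (m.X i t ω))
        (m.P A) := by
      refine Integrable.of_bound ((hW.mono (m.past_le t) le_rfl).mul hXm).aestronglyMeasurable
        ((2 * (t * C)) * C) (ae_of_all _ fun ω => ?_)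
      rw [Pi.mul_apply, norm_mul]
      have hp : 0 ≤ t * C := (abs_nonneg _).trans (hTb ω)
      refine mul_le_mul ?_ (hCnn ω) (abs_nonneg _) (by positivity)
      by_cases hω : ω ∈ G t
      · simpa [hω, abs_mul] using hTb ω
      · simpa [hω] using hp
    have i3 : Integrable ((G t).indicator (fun ω => h (m.X i t ω) ^ 2)) (m.P A) := by
      refine Integrable.indicator ?_ hGm
      refine Integrable.of_bound (hXm.pow_const 2).aestronglyMeasurable (C ^ 2)
        (ae_of_all _ fun ω => ?_)
      rw [Real.norm_eq_abs, abs_pow]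
      exact pow_le_pow_left₀ (abs_nonneg _) (hCnn ω) 2
    have hind : IndepFun ((G t).indicator fun ω => 2 * T ω) (fun ω => h (m.X i t ω)) (m.P A) := by
      have hI := m.indep_X_dataInfo A (p := (i, t)) (Q := {q | q.2 < t}) (by simp)
      rw [IndepFun_iff_Indep]
      refine indep_of_indep_of_le_left (indep_of_indep_of_le_right hI.symm ?_) hW.comap_le
      exact (hh.comp (comap_measurable (m.X i t))).comap_le
    -- The cross term vanishes: its first factor is determined by the past, and the new observation
    -- is independent of the past and centered.
    have z2 : ∫ ω, ((G t).indicator (fun ω => 2 * T ω) * fun ω => h (m.X i t ω)) ω ∂(m.P A) = 0 := by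
      rw [hind.integral_mul_eq_mul_integral
        (hW.mono (m.past_le t) le_rfl).aestronglyMeasurable hXm.aestronglyMeasurable,
        m.integral_comp_X A i t hh, h0, mul_zero]
    have z3 : ∫ ω, (G t).indicator (fun ω => h (m.X i t ω) ^ 2) ω ∂(m.P A) ≤ C ^ 2 := by
      have : ∫ ω, (G t).indicator (fun ω => h (m.X i t ω) ^ 2) ω ∂(m.P A) ≤
          ∫ _, C ^ 2 ∂(m.P A) := by
        refine integral_mono i3 (integrable_const _) fun ω => ?_
        by_cases hω : ω ∈ G t
        · simp only [hω, Set.indicator_of_mem]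
          rw [← sq_abs]
          exact pow_le_pow_left₀ (abs_nonneg _) (hCnn ω) 2
        · simp only [hω, not_false_eq_true, Set.indicator_of_notMem]
          positivity
      simpa using this
    simp_rw [e]
    rw [integral_add (f := fun ω => (T ω) ^ 2 +
      ((G t).indicator (fun ω => 2 * T ω) * fun ω => h (m.X i t ω)) ω) (i1.add i2) i3,
      integral_add i1 i2, z2]
    push_cast
    linarith

/-- A one-sided weak law of large numbers for the log-likelihood ratios of a source at the times
at which it is selected, uniform over the selection rules. -/
theorem selectedSum_ell_le (hKL : m.KLPosFinite) (A : Finset (Fin M)) (i : Fin M) {δ η : ℝ}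
    (hδ : 0 < δ) (hη : 0 < η) : ∃ t₀ : ℕ, ∀ t ≥ t₀, ∀ G : ℕ → Set Ω,
      (∀ n, MeasurableSet[m.past n] (G n)) →
      (m.P A).real {ω | δ * t ≤
        m.selectedSum i (fun x => m.ell A i x - m.klNumber A i) G t ω} ≤ η := by
  -- `δ / 3` absorbs the error in the mean; `η * δ / 6` makes Markov's inequality for the
  -- approximation error give `η / 2`.
  set ρ : ℝ := min (δ / 3) (η * δ / 6) with hρ
  have hρ0 : 0 < ρ := by positivity
  have hint := integrable_ell hKL A i
  obtain ⟨g, hg, hgL⟩ := (memLp_one_iff_integrable.2 hint).exists_simpleFunc_eLpNorm_sub_lt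
    ENNReal.one_ne_top (ε := ENNReal.ofReal ρ) (by simpa using hρ0)
  have hgi : Integrable g (m.law A i) := memLp_one_iff_integrable.1 hgL
  have hel : Measurable (m.ell A i) := measurable_ell A i
  have hgm : Measurable g := g.measurable
  have hem : Measurable fun x => |m.ell A i x - g x| := (hel.sub hgm).abs
  have hei : Integrable (fun x => |m.ell A i x - g x|) (m.law A i) := (hint.sub hgi).abs
  have hρe : ∫ x, |m.ell A i x - g x| ∂(m.law A i) ≤ ρ := by
    have h1 := eLpNorm_one_eq_lintegral_enorm (f := m.ell A i - ⇑g) (μ := m.law A i)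
    have h2 := ofReal_integral_norm_eq_lintegral_enorm (hint.sub hgi)
    rw [← h1] at h2
    rw [← ENNReal.ofReal_le_ofReal_iff hρ0.le]
    exact h2.le.trans hg.le
  have hF := integral_ell hKL A i
  set c := ∫ x, g x ∂(m.law A i) with hc
  have hcF : c - m.klNumber A i ≤ ρ := by
    rw [← hF, hc, ← integral_sub hgi hint]
    refine (integral_mono (hgi.sub hint) hei fun x => ?_).trans hρe
    show g x - m.ell A i x ≤ |m.ell A i x - g x|
    rw [abs_sub_comm]
    exact le_abs_self _
  obtain ⟨C, hC⟩ := g.exists_forall_norm_le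
  set h : S → ℝ := fun x => g x - c with hh
  have hhm : Measurable h := hgm.sub_const c
  have hh0 : ∫ x, h x ∂(m.law A i) = 0 := by
    rw [hh, integral_sub hgi (integrable_const c)]
    simp [hc]
  have hhC : ∀ x, |h x| ≤ C + |c| := fun x =>
    (abs_sub _ _).trans (add_le_add_left (hC x) _)
  -- The threshold at which Chebyshev's bound `t (C + |c|)² / (δ t / 3)²` falls below `η / 2`.
  obtain ⟨t₀, ht₀⟩ := exists_nat_gt (18 * (C + |c|) ^ 2 / (δ ^ 2 * η))
  refine ⟨t₀ + 1, fun t ht G hG => ?_⟩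
  have htpos : (0 : ℝ) < t := by exact_mod_cast (by omega : 0 < t)
  have ht' : 18 * (C + |c|) ^ 2 / (δ ^ 2 * η) < t :=
    ht₀.trans_le (by exact_mod_cast (by omega : t₀ ≤ t))
  set S2 : Ω → ℝ := fun ω => ∑ s ∈ Finset.range t, |m.ell A i (m.X i s ω) - g (m.X i s ω)| with hS2
  -- The deviation is at most the selected sum of `g - c`, plus `S2`, plus the mean error `t ρ ≤ δ t
  -- / 3`; hence one of the first two reaches `δ t / 3`. `S2` runs over all times and does not
  -- involve `G`.
  have hsub : {ω | δ * t ≤ m.selectedSum i (fun x => m.ell A i x - m.klNumber A i) G t ω} ⊆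
      {ω | (δ * t / 3) ^ 2 ≤ m.selectedSum i h G t ω ^ 2} ∪ {ω | δ * t / 3 ≤ S2 ω} := by
    intro ω hω
    by_contra hcon
    simp only [Set.mem_union, Set.mem_ofPred_eq, not_or, not_le] at hcon hω
    have h1 : m.selectedSum i h G t ω < δ * t / 3 :=
      lt_of_pow_lt_pow_left₀ 2 (by positivity) hcon.1
    have h3 : m.selectedSum i (fun x => m.ell A i x - m.klNumber A i) G t ω ≤
        m.selectedSum i h G t ω + S2 ω + t * ρ := by
      have e : (t : ℝ) * ρ = ∑ s ∈ Finset.range t, ρ := by simp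
      rw [selectedSum, selectedSum, hS2, e, ← Finset.sum_add_distrib, ← Finset.sum_add_distrib]
      refine Finset.sum_le_sum fun s _ => ?_
      by_cases hs : ω ∈ G s
      · simp only [hs, Set.indicator_of_mem, hh]
        have := le_abs_self (m.ell A i (m.X i s ω) - g (m.X i s ω))
        linarith
      · simp only [hs, not_false_eq_true, Set.indicator_of_notMem]
        positivity
    have h4 : (t : ℝ) * ρ ≤ δ * t / 3 := by
      have := mul_le_mul_of_nonneg_left (min_le_left (δ / 3) (η * δ / 6)) htpos.le
      rw [← hρ] at this
      linarith
    linarith [hcon.2]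
  have hS1i : Integrable (fun ω => m.selectedSum i h G t ω ^ 2) (m.P A) := by
    refine Integrable.of_bound (((m.measurable_selectedSum hhm hG t).mono
      (m.past_le t) le_rfl).pow_const 2).aestronglyMeasurable ((t * (C + |c|)) ^ 2)
        (ae_of_all _ fun ω => ?_)
    rw [Real.norm_eq_abs, abs_pow]
    exact pow_le_pow_left₀ (abs_nonneg _) (m.abs_selectedSum_le hhC G t ω) 2
  have hterm : ∀ s, Integrable (fun ω => |m.ell A i (m.X i s ω) - g (m.X i s ω)|) (m.P A) := by
    intro s
    have : Integrable (fun x => |m.ell A i x - g x|) ((m.P A).map (m.X i s)) := by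
      rwa [m.map_X]
    exact this.comp_measurable (m.measurable_X i s)
  have hS2i : Integrable S2 (m.P A) := integrable_finsetSum _ fun s _ => hterm s
  have hS2e : ∫ ω, S2 ω ∂(m.P A) ≤ t * ρ := by
    rw [hS2, integral_finsetSum _ fun s _ => hterm s]
    have : ∀ s ∈ Finset.range t,
        ∫ ω, |m.ell A i (m.X i s ω) - g (m.X i s ω)| ∂(m.P A) ≤ ρ := fun s _ => by
      rw [m.integral_comp_X A i s hem]
      exact hρe
    simpa using Finset.sum_le_card_nsmul _ _ _ this
  have b1 : (m.P A).real {ω | (δ * t / 3) ^ 2 ≤ m.selectedSum i h G t ω ^ 2} ≤ η / 2 := by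
    have h1 := mul_meas_ge_le_integral_of_nonneg (ae_of_all _ fun ω => sq_nonneg _) hS1i
      ((δ * t / 3) ^ 2)
    have h2 := m.integral_selectedSum_sq_le A hhm hhC hh0 hG t
    have h3 : (t : ℝ) * (C + |c|) ^ 2 ≤ (δ * t / 3) ^ 2 * (η / 2) := by
      rw [div_lt_iff₀ (by positivity)] at ht'
      nlinarith [mul_le_mul_of_nonneg_left ht'.le htpos.le]
    have h4 := (h1.trans h2).trans h3
    exact le_of_mul_le_mul_left h4 (by positivity)
  have b2 : (m.P A).real {ω | δ * t / 3 ≤ S2 ω} ≤ η / 2 := by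
    have h1 := mul_meas_ge_le_integral_of_nonneg
      (ae_of_all _ fun ω => Finset.sum_nonneg fun s _ => abs_nonneg _) hS2i (δ * t / 3)
    have h3 : (t : ℝ) * ρ ≤ (δ * t / 3) * (η / 2) := by
      have := mul_le_mul_of_nonneg_left (min_le_right (δ / 3) (η * δ / 6)) htpos.le
      rw [← hρ] at this
      linarith
    exact le_of_mul_le_mul_left ((h1.trans hS2e).trans h3) (by positivity)
  calc _ ≤ _ := measureReal_mono hsub
    _ ≤ _ := measureReal_union_le _ _
    _ ≤ η := by linarith

end Model

/-! ### The max-min problem for sampling frequencies -/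

section MaxMin

variable {M : ℕ} {κ : ℕ} {K : ℝ} {L : Fin M → ℝ}

theorem nonempty_card_eq (hκ : κ ≤ M) : Nonempty {U : Finset (Fin M) // U.card = κ} := by
  obtain ⟨U, -, hU⟩ := Finset.exists_subset_card_eq (s := (Finset.univ : Finset (Fin M)))
    (n := κ) (by simpa using hκ)
  exact ⟨⟨U, hU⟩⟩

theorem exists_minInfo_eq (hκ : κ ≤ M) (c L : Fin M → ℝ) :
    ∃ U : Finset (Fin M), U.card = κ ∧ ∑ i ∈ U, c i * L i = minInfo c κ L := by
  have := nonempty_card_eq hκ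
  obtain ⟨U, hU⟩ := exists_eq_ciInf_of_finite
    (f := fun U : {U : Finset (Fin M) // U.card = κ} => ∑ i ∈ U.1, c i * L i)
  exact ⟨U.1, U.2, hU⟩

theorem minInfo_le_maxMinValue (hκ : κ ≤ M) {c : Fin M → ℝ} (hc : c ∈ frequencyDomain M K) :
    minInfo c κ L ≤ maxMinValue κ K L := by
  refine le_csSup ⟨∑ i, |L i|, ?_⟩ ⟨c, hc, rfl⟩
  rintro _ ⟨c, hc, rfl⟩
  obtain ⟨U, -, hU⟩ := exists_minInfo_eq hκ c L
  show minInfo c κ L ≤ _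
  rw [← hU]
  refine (Finset.sum_le_sum fun i _ => ?_).trans
    (Finset.sum_le_sum_of_subset_of_nonneg (Finset.subset_univ U) fun i _ _ => abs_nonneg (L i))
  calc c i * L i ≤ |c i * L i| := le_abs_self _
    _ = c i * |L i| := by rw [abs_mul, abs_of_nonneg (hc.1 i).1]
    _ ≤ |L i| := mul_le_of_le_one_left (abs_nonneg _) (hc.1 i).2

/-- For every vector of frequencies some `κ` sources carry at most the max-min information, with
respect to any reordering of the information numbers. -/
theorem exists_sum_le_maxMinValue (hκ : κ ≤ M) (σ : Equiv.Perm (Fin M)) {c : Fin M → ℝ}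
    (hc : c ∈ frequencyDomain M K) :
    ∃ U : Finset (Fin M), U.card = κ ∧ ∑ i ∈ U, c i * L i ≤ maxMinValue κ K (L ∘ σ) := by
  have hc' : c ∘ σ ∈ frequencyDomain M K :=
    ⟨fun i => hc.1 (σ i), by simpa using (Equiv.sum_comp σ c).trans_le hc.2⟩
  obtain ⟨U, hU, hUe⟩ := exists_minInfo_eq hκ (c ∘ σ) (L ∘ σ)
  refine ⟨U.map σ.toEmbedding, by simpa using hU, ?_⟩
  rw [Finset.sum_map]
  exact hUe.trans_le (minInfo_le_maxMinValue hκ hc')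

/-- The uniform frequencies `K / M` are feasible and give every nonempty set positive information.
-/
theorem maxMinValue_pos (hκ1 : 1 ≤ κ) (hκ : κ ≤ M) (hK : 0 < K) (hKM : K ≤ M)
    (hL : ∀ i, 0 < L i) : 0 < maxMinValue κ K L := by
  have hM : (0 : ℝ) < M := by exact_mod_cast hκ1.trans hκ
  have hc : (fun _ => K / M) ∈ frequencyDomain M K := by
    refine ⟨fun _ => ⟨by positivity, (div_le_one hM).2 hKM⟩, ?_⟩
    simp only [Finset.sum_const, Finset.card_univ, Fintype.card_fin, nsmul_eq_mul]
    exact (mul_div_cancel₀ K hM.ne').le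
  refine lt_of_lt_of_le ?_ (minInfo_le_maxMinValue hκ hc)
  obtain ⟨U, hU, hUe⟩ := exists_minInfo_eq hκ (fun _ : Fin M => K / M) L
  rw [← hUe]
  refine Finset.sum_pos (fun i _ => mul_pos (by positivity) (hL i)) ?_
  rw [← Finset.card_pos]
  omega

end MaxMin

/-! ### Error events and the lower bound on the stopping time -/

namespace Model

variable {M : ℕ} {S Ω : Type*} [MeasurableSpace S] [mΩ : MeasurableSpace Ω] {m : Model M S Ω}

/-- The event that a policy stops at time `n` and misclassifies at least `k` sources when `B` is the
set of anomalous sources. -/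
def Policy.errorAt (p : m.Policy) (B : Finset (Fin M)) (k n : ℕ) : Set Ω :=
  {ω | p.T ω = n ∧ k ≤ (symmDiff B (p.Δ ω)).card}

theorem Policy.measurableSet_errorAt (p : m.Policy) (B : Finset (Fin M)) (k n : ℕ) :
    MeasurableSet[m.info p.R n] (p.errorAt B k n) := by
  have : p.errorAt B k n = ⋃ D : {D : Finset (Fin M) // k ≤ (symmDiff B D).card},
      {ω | p.T ω = n ∧ p.Δ ω = D.1} := by
    ext ω
    simp only [errorAt, Set.mem_ofPred_eq, Set.mem_iUnion]
    constructor
    · rintro ⟨h1, h2⟩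
      exact ⟨⟨p.Δ ω, h2⟩, h1, rfl⟩
    · rintro ⟨D, h1, h2⟩
      exact ⟨h1, h2 ▸ D.2⟩
  rw [this]
  exact MeasurableSet.iUnion fun D => p.decision_rule n D.1

/-- The log-likelihood ratio, at time `n`, of the sampled observations from sources in `U`. -/
noncomputable def Policy.logLik (p : m.Policy) (A U : Finset (Fin M)) (n : ℕ) (ω : Ω) : ℝ :=
  ∑ s ∈ Finset.range n, ∑ i, if i ∈ p.R s ω then
    (if i ∈ U then m.ell A i (m.X i s ω) else 0) else 0

theorem Policy.likelihood_eq (p : m.Policy) (A U : Finset (Fin M)) (n : ℕ) (ω : Ω) :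
    m.likelihood A U p.R n ω = ENNReal.ofReal (Real.exp (-p.logLik A U n ω)) := by
  unfold likelihood logLik
  rw [← Finset.sum_neg_distrib, Real.exp_sum,
    ENNReal.ofReal_prod_of_nonneg fun _ _ => (Real.exp_pos _).le]
  refine Finset.prod_congr rfl fun s _ => ?_
  rw [← Finset.sum_neg_distrib, Real.exp_sum,
    ENNReal.ofReal_prod_of_nonneg fun _ _ => (Real.exp_pos _).le]
  refine Finset.prod_congr rfl fun i _ => ?_
  by_cases h1 : i ∈ p.R s ω <;> by_cases h2 : i ∈ U <;> simp [h1, h2]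

theorem Policy.P_errorAt_inter_le (hKL : m.KLPosFinite) (p : m.Policy) (A U : Finset (Fin M))
    (k n : ℕ) (a : ℝ) :
    m.P A (p.errorAt (symmDiff A U) k n ∩ {ω | p.logLik A U n ω ≤ a}) ≤
      ENNReal.ofReal (Real.exp a) * m.P (symmDiff A U) (p.errorAt (symmDiff A U) k n) := by
  have hE := m.info_le_fullInfo p.R n _ (p.measurableSet_errorAt (symmDiff A U) k n)
  set E := p.errorAt (symmDiff A U) k n with hEdef
  rw [m.P_symmDiff_eq hKL A U p.sampling_rule n hE]
  have hle := m.fullInfo_le p.sampling_rule n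
  have hLm : Measurable (m.likelihood A U p.R n) :=
    (m.measurable_likelihood A U p.sampling_rule n).mono hle le_rfl
  -- A level set of the likelihood contains the event `logLik ≤ a` and is measurable by
  -- `measurable_likelihood`.
  set H : Set Ω := {ω | ENNReal.ofReal (Real.exp (-a)) ≤ m.likelihood A U p.R n ω} with hH
  have hHm : MeasurableSet H := measurableSet_le measurable_const hLm
  have hsub : E ∩ {ω | p.logLik A U n ω ≤ a} ⊆ E ∩ H := by
    rintro ω ⟨h1, h2⟩
    refine ⟨h1, ?_⟩
    show ENNReal.ofReal (Real.exp (-a)) ≤ m.likelihood A U p.R n ω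
    rw [p.likelihood_eq]
    exact ENNReal.ofReal_le_ofReal (Real.exp_le_exp.2 (neg_le_neg h2))
  have hmul : ENNReal.ofReal (Real.exp a) * ENNReal.ofReal (Real.exp (-a)) = 1 := by
    rw [← ENNReal.ofReal_mul (Real.exp_pos a).le, ← Real.exp_add]
    simp
  calc m.P A (E ∩ {ω | p.logLik A U n ω ≤ a}) ≤ m.P A (E ∩ H) := measure_mono hsub
    _ = ENNReal.ofReal (Real.exp a) * (ENNReal.ofReal (Real.exp (-a)) * m.P A (E ∩ H)) := by
        rw [← mul_assoc, hmul, one_mul]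
    _ ≤ ENNReal.ofReal (Real.exp a) * ∫⁻ ω in E ∩ H, m.likelihood A U p.R n ω ∂(m.P A) := by
        gcongr
        rw [← setLIntegral_const]
        exact setLIntegral_mono hLm fun ω hω => hω.2
    _ ≤ _ := by
        gcongr
        exact Set.inter_subset_left

theorem Policy.sum_P_errorAt_le {p : m.Policy} {α : ℝ} {k : ℕ} (hp : p.ErrorConstraint α k)
    (B : Finset (Fin M)) (t : ℕ) :
    ∑ n ∈ Finset.range (t + 1), m.P B (p.errorAt B k n) ≤ ENNReal.ofReal α := by
  rw [← measure_biUnion_finset]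
  · refine (measure_mono ?_).trans (hp B)
    refine Set.iUnion₂_subset fun n _ ω hω => ⟨?_, hω.2⟩
    rw [hω.1]
    exact ENat.natCast_ne_top n
  · intro n _ n' _ hne
    refine Set.disjoint_left.2 fun ω h1 h2 => hne ?_
    exact_mod_cast h1.1.symm.trans h2.1
  · exact fun n _ => m.fullInfo_le p.sampling_rule n _
      (m.info_le_fullInfo p.R n _ (p.measurableSet_errorAt B k n))

/-- The event that source `i` is sampled at time `s + 1`, before stopping. -/
def Policy.selected (p : m.Policy) (i : Fin M) (s : ℕ) : Set Ω := {ω | i ∈ p.R s ω ∧ s < p.T ω}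

/-- Whether sampling goes on beyond time `s`, and from which sources, is decided before the
observations `X i s`; thus `selected` is an admissible selection rule for the weak law. -/
theorem Policy.measurableSet_selected (p : m.Policy) (i : Fin M) (s : ℕ) :
    MeasurableSet[m.past s] (p.selected i s) := by
  have h : p.selected i s = {ω | i ∈ p.R s ω} ∩
      ⋂ j : {j : ℕ // j ≤ s}, {ω | p.T ω = (j.1 : ℕ)}ᶜ := by
    ext ω
    simp only [selected, Set.mem_ofPred_eq, Set.mem_inter_iff, Set.mem_iInter, Set.mem_compl_iff]
    refine and_congr_right fun _ => ⟨?_, fun h => ?_⟩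
    · rintro h ⟨j, hj⟩ hT
      rw [hT] at h
      have : s < j := by exact_mod_cast h
      omega
    · by_contra hlt
      have hle : p.T ω ≤ s := not_lt.1 hlt
      obtain ⟨j, hj⟩ := ENat.ne_top_iff_exists.1 (ne_top_of_le_ne_top (ENat.natCast_ne_top s) hle)
      rw [← hj] at hle
      exact h ⟨j, by exact_mod_cast hle⟩ hj.symm
  have hle := m.fullInfo_le_dataInfo p.sampling_rule s
  refine hle _ ?_
  rw [h]
  refine (m.measurableSet_mem p.sampling_rule s i).inter (MeasurableSet.iInter fun j => ?_)
  exact (m.fullInfo_mono p.R j.2 _ (m.info_le_fullInfo p.R j.1 _ (p.stopping_rule j.1))).compl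

/-- Selection ceases at `T`, so the sum is frozen there. The weak law at the single horizon `t` thus
covers every `T ≤ t`, without a maximal inequality. -/
theorem Policy.selectedSum_eq (p : m.Policy) (i : Fin M) (h : S → ℝ) {ω : Ω} {n t : ℕ}
    (hT : p.T ω = n) (hn : n ≤ t) :
    m.selectedSum i h (p.selected i) t ω =
      ∑ s ∈ Finset.range n, if i ∈ p.R s ω then h (m.X i s ω) else 0 := by
  classical
  unfold selectedSum
  rw [← Finset.sum_subset (Finset.range_mono hn)]
  · refine Finset.sum_congr rfl fun s hs => ?_
    have : (s : ℕ∞) < p.T ω := by rw [hT]; exact_mod_cast Finset.mem_range.1 hs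
    simp [Set.indicator, selected, this]
  · intro s _ hs
    have : ¬ (s : ℕ∞) < p.T ω := by
      rw [hT]
      exact_mod_cast fun h => hs (Finset.mem_range.2 h)
    simp [Set.indicator, selected, this]

/-- When the log-likelihood ratios obey the law of large numbers, some set `U` of sources has a
small log-likelihood ratio although the decision errs at least `k` times against `A ∆ U`. -/
theorem Policy.exists_errorAt_logLik_le (p : m.Policy) (hKL : m.KLPosFinite) (A : Finset (Fin M))
    {k : ℕ} (hkM : k ≤ M) {K : ℝ} {δ a : ℝ} (hδ : 0 ≤ δ) {n t : ℕ} {ω : Ω} (hT : p.T ω = n)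
    (hn : n ≤ t) (hK : (∑ s ∈ Finset.range n, ((p.R s ω).card : ℝ)) / n ≤ K)
    (hV : 0 ≤ maxMinValue k K (m.orderedKL A))
    (ha : maxMinValue k K (m.orderedKL A) * t + M * (δ * t) ≤ a)
    (hbad : ∀ i, m.selectedSum i (fun x => m.ell A i x - m.klNumber A i) (p.selected i) t ω
      < δ * t) :
    ∃ U : Finset (Fin M), ω ∈ p.errorAt (symmDiff A U) k n ∧ p.logLik A U n ω ≤ a := by
  classical
  have hn1 : 1 ≤ n := by
    have := p.one_le_T ω
    rw [hT] at this
    exact_mod_cast this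
  have hn0 : (0 : ℝ) < n := by exact_mod_cast hn1
  set N : Fin M → ℝ := fun i => ∑ s ∈ Finset.range n, if i ∈ p.R s ω then (1 : ℝ) else 0 with hN
  have hNnn : ∀ i, 0 ≤ N i := fun i => Finset.sum_nonneg fun s _ => by split_ifs <;> simp
  have hc : (fun i => N i / n) ∈ frequencyDomain M K := by
    refine ⟨fun i => ⟨div_nonneg (hNnn i) hn0.le, (div_le_one hn0).2 ?_⟩, ?_⟩
    · have : ∀ s ∈ Finset.range n, (if i ∈ p.R s ω then (1 : ℝ) else 0) ≤ 1 :=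
        fun s _ => by split_ifs <;> simp
      exact (Finset.sum_le_card_nsmul _ _ _ this).trans_eq (by simp)
    · rw [← Finset.sum_div]
      refine (div_le_div_of_nonneg_right (le_of_eq ?_) hn0.le).trans hK
      rw [hN, Finset.sum_comm]
      refine Finset.sum_congr rfl fun s _ => ?_
      simp
  obtain ⟨U', hU', hsum⟩ := exists_sum_le_maxMinValue (L := m.klNumber A) hkM
    (Tuple.sort (m.klNumber A)) hc
  set W := symmDiff A (p.Δ ω) with hW
  -- Removing `W` keeps existing errors from being undone: `W ∆ (U' \ W) = W ∪ U'` contains `U'`.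
  refine ⟨U' \ W, ⟨hT, ?_⟩, ?_⟩
  · have e : symmDiff (symmDiff A (U' \ W)) (p.Δ ω) = symmDiff W (U' \ W) := by
      rw [hW, symmDiff_right_comm]
    rw [e, ← hU']
    refine Finset.card_le_card fun i hi => ?_
    by_cases hiW : i ∈ W <;> simp [hi, hiW]
  · have hlog : p.logLik A (U' \ W) n ω = ∑ i ∈ U' \ W,
        (m.selectedSum i (fun x => m.ell A i x - m.klNumber A i) (p.selected i) t ω +
          N i * m.klNumber A i) := by
      have h1 : ∀ i, m.selectedSum i (fun x => m.ell A i x - m.klNumber A i) (p.selected i) t ω +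
          N i * m.klNumber A i =
          ∑ s ∈ Finset.range n, if i ∈ p.R s ω then m.ell A i (m.X i s ω) else 0 := by
        intro i
        rw [p.selectedSum_eq i _ hT hn, hN, Finset.sum_mul, ← Finset.sum_add_distrib]
        refine Finset.sum_congr rfl fun s _ => ?_
        split_ifs <;> simp
      simp_rw [h1]
      rw [Finset.sum_comm]
      refine Finset.sum_congr rfl fun s _ => ?_
      rw [← Finset.sum_subset (Finset.subset_univ (U' \ W))]
      · refine Finset.sum_congr rfl fun i hi => ?_
        rw [if_pos hi]
      · intro i _ hi
        rw [if_neg hi, ite_self]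
    rw [hlog, Finset.sum_add_distrib]
    have hnt : (n : ℝ) ≤ t := by exact_mod_cast hn
    have b1 : ∑ i ∈ U' \ W, m.selectedSum i (fun x => m.ell A i x - m.klNumber A i)
        (p.selected i) t ω ≤ M * (δ * t) := by
      refine (Finset.sum_le_card_nsmul _ _ _ fun i _ => (hbad i).le).trans ?_
      rw [nsmul_eq_mul]
      refine mul_le_mul_of_nonneg_right ?_ (by positivity)
      exact_mod_cast (Finset.card_le_univ (U' \ W)).trans_eq (Fintype.card_fin M)
    -- Passing from `U' \ W` to `U'` only adds information, as the numbers are positive.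
    have b2 : ∑ i ∈ U' \ W, N i * m.klNumber A i ≤ maxMinValue k K (m.orderedKL A) * t := by
      calc ∑ i ∈ U' \ W, N i * m.klNumber A i ≤ ∑ i ∈ U', N i * m.klNumber A i :=
            Finset.sum_le_sum_of_subset_of_nonneg Finset.sdiff_subset fun i _ _ =>
              mul_nonneg (hNnn i) (klNumber_pos hKL A i).le
        _ = (∑ i ∈ U', N i / n * m.klNumber A i) * n := by
            rw [Finset.sum_mul]
            refine Finset.sum_congr rfl fun i _ => ?_
            field_simp
        _ ≤ maxMinValue k K (m.orderedKL A) * n := mul_le_mul_of_nonneg_right hsum hn0.le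
        _ ≤ _ := mul_le_mul_of_nonneg_left hnt hV
    linarith

/-- A bound on the probability of stopping early, for every admissible policy. -/
theorem Policy.P_T_le_le (p : m.Policy) (hKL : m.KLPosFinite) (A : Finset (Fin M))
    {k : ℕ} (hkM : k ≤ M) {K α : ℝ} (hα : 0 ≤ α) (hp : p ∈ m.admissible α k K) {δ a η : ℝ}
    (hδ : 0 ≤ δ) {t : ℕ}
    (hV : 0 ≤ maxMinValue k K (m.orderedKL A))
    (ha : maxMinValue k K (m.orderedKL A) * t + M * (δ * t) ≤ a)
    (hbad : ∀ i, (m.P A).real {ω | δ * t ≤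
      m.selectedSum i (fun x => m.ell A i x - m.klNumber A i) (p.selected i) t ω} ≤ η) :
    (m.P A).real {ω | p.T ω ≤ t} ≤ 2 ^ M * (Real.exp a * α) + M * η := by
  classical
  set H : Finset (Fin M) → Set Ω := fun U => ⋃ n ∈ Finset.range (t + 1),
    (p.errorAt (symmDiff A U) k n ∩ {ω | p.logLik A U n ω ≤ a}) with hH
  set Bd : Fin M → Set Ω := fun i => {ω | δ * t ≤
      m.selectedSum i (fun x => m.ell A i x - m.klNumber A i) (p.selected i) t ω} with hBd
  -- Inclusion holds only almost surely because the sampling constraint does.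
  have hsub : {ω | p.T ω ≤ t} ≤ᵐ[m.P A]
      ((⋃ U ∈ (Finset.univ : Finset (Finset (Fin M))), H U) ∪
        ⋃ i ∈ (Finset.univ : Finset (Fin M)), Bd i : Set Ω) := by
    filter_upwards [hp.1 A] with ω hω hTt
    have hTt : p.T ω ≤ t := hTt
    obtain ⟨n, hn⟩ := ENat.ne_top_iff_exists.1 (ne_top_of_le_ne_top (ENat.natCast_ne_top t) hTt)
    have hnt : n ≤ t := by rw [← hn] at hTt; exact_mod_cast hTt
    show ω ∈ ((⋃ U ∈ (Finset.univ : Finset (Finset (Fin M))), H U) ∪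
        ⋃ i ∈ (Finset.univ : Finset (Fin M)), Bd i : Set Ω)
    by_cases hb : ∃ i, ω ∈ Bd i
    · obtain ⟨i, hi⟩ := hb
      exact Or.inr (Set.mem_iUnion₂.2 ⟨i, Finset.mem_univ i, hi⟩)
    · push Not at hb
      obtain ⟨U, hU1, hU2⟩ := p.exists_errorAt_logLik_le hKL A hkM hδ hn.symm hnt
        (hω n hn.symm) hV ha fun i => not_le.1 (hb i)
      exact Or.inl (Set.mem_iUnion₂.2 ⟨U, Finset.mem_univ U, Set.mem_iUnion₂.2
        ⟨n, Finset.mem_range.2 (by omega), hU1, hU2⟩⟩)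
  have hHb : ∀ U, (m.P A).real (H U) ≤ Real.exp a * α := by
    intro U
    rw [measureReal_def]
    refine ENNReal.toReal_le_of_le_ofReal (by positivity) ?_
    rw [ENNReal.ofReal_mul (Real.exp_pos a).le]
    calc m.P A (H U) ≤ ∑ n ∈ Finset.range (t + 1),
          m.P A (p.errorAt (symmDiff A U) k n ∩ {ω | p.logLik A U n ω ≤ a}) :=
          measure_biUnion_finset_le _ _
      _ ≤ ∑ n ∈ Finset.range (t + 1), ENNReal.ofReal (Real.exp a) *
          m.P (symmDiff A U) (p.errorAt (symmDiff A U) k n) :=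
          Finset.sum_le_sum fun n _ => p.P_errorAt_inter_le hKL A U k n a
      _ ≤ _ := by
          rw [← Finset.mul_sum]
          gcongr
          exact Policy.sum_P_errorAt_le hp.2 _ t
  have h0 : (m.P A).real {ω | p.T ω ≤ t} ≤ (m.P A).real
      ((⋃ U ∈ (Finset.univ : Finset (Finset (Fin M))), H U) ∪
        ⋃ i ∈ (Finset.univ : Finset (Fin M)), Bd i) :=
    ENNReal.toReal_mono (measure_ne_top _ _) (measure_mono_ae hsub)
  have h1 : (m.P A).real (⋃ U ∈ (Finset.univ : Finset (Finset (Fin M))), H U) ≤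
      2 ^ M * (Real.exp a * α) := by
    refine (measureReal_biUnion_finset_le _ _).trans ?_
    simpa using Finset.sum_le_card_nsmul Finset.univ _ _ fun U _ => hHb U
  have h2 : (m.P A).real (⋃ i ∈ (Finset.univ : Finset (Fin M)), Bd i) ≤ M * η := by
    refine (measureReal_biUnion_finset_le _ _).trans ?_
    simpa using Finset.sum_le_card_nsmul Finset.univ _ _ fun i _ => hbad i
  exact h0.trans ((measureReal_union_le _ _).trans (add_le_add h1 h2))

theorem Policy.measurableSet_T_le (p : m.Policy) (t : ℕ) : MeasurableSet {ω | p.T ω ≤ t} := by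
  have : {ω | p.T ω ≤ t} = ⋃ n : {n : ℕ // n ≤ t}, {ω | p.T ω = (n.1 : ℕ)} := by
    ext ω
    simp only [Set.mem_ofPred_eq, Set.mem_iUnion]
    constructor
    · intro h
      obtain ⟨n, hn⟩ := ENat.ne_top_iff_exists.1 (ne_top_of_le_ne_top (ENat.natCast_ne_top t) h)
      rw [← hn] at h
      exact ⟨⟨n, by exact_mod_cast h⟩, hn.symm⟩
    · rintro ⟨⟨n, hn⟩, h⟩
      rw [h]
      exact_mod_cast hn
  rw [this]
  exact MeasurableSet.iUnion fun n => m.fullInfo_le p.sampling_rule n.1 _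
    (m.info_le_fullInfo p.R n.1 _ (p.stopping_rule n.1))

/-- Markov's inequality; since `T` is integer-valued, `T > t` means `T ≥ t + 1`, which later offsets
rounding `t` down. -/
theorem Policy.le_lintegral_T (p : m.Policy) (A : Finset (Fin M)) (t : ℕ) :
    ENNReal.ofReal ((t + 1) * (1 - (m.P A).real {ω | p.T ω ≤ t})) ≤
      ∫⁻ ω, ((p.T ω : ℕ∞) : ℝ≥0∞) ∂(m.P A) := by
  have hm := p.measurableSet_T_le t
  rw [← probReal_compl_eq_one_sub hm, ENNReal.ofReal_mul (by positivity), ofReal_measureReal,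
    ← lintegral_indicator_const hm.compl]
  refine lintegral_mono fun ω => ?_
  by_cases h : p.T ω ≤ t
  · simp [h]
  · have hlt : (t : ℕ∞) + 1 ≤ p.T ω := Order.add_one_le_of_lt (not_le.1 h)
    have h2 : (((t : ℕ∞) + 1 : ℕ∞) : ℝ≥0∞) ≤ ((p.T ω : ℕ∞) : ℝ≥0∞) := ENat.toENNReal_le.2 hlt
    have h3 : ENNReal.ofReal ((t : ℝ) + 1) = (((t : ℕ∞) + 1 : ℕ∞) : ℝ≥0∞) := by
      rw [ENNReal.ofReal_add (by positivity) zero_le_one]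
      simp
    simpa [Set.indicator, h, h3] using h2

/-- The smallest expected time for stopping is eventually at least any fraction `c < 1` of
`|log α| / V`. -/
theorem eventually_le_optimalTime (hKL : m.KLPosFinite) {k : ℕ} (hk : 1 ≤ k) (hkM : k ≤ M) {K : ℝ}
    (A : Finset (Fin M))
    (hV : 0 < maxMinValue k K (m.orderedKL A)) {c : ℝ} (hc : c < 1) :
    ∀ᶠ α : ℝ in 𝓝[>] 0, ENNReal.ofReal (c * (|Real.log α| /
      maxMinValue k K (m.orderedKL A))) ≤ m.optimalTime A α k K := by
  set V := maxMinValue k K (m.orderedKL A) with hVdef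
  have hM : (0 : ℝ) < M := by exact_mod_cast hk.trans hkM
  -- One factor `1 - ε` is lost in the horizon, the other in the probability; `(1 - ε)² ≥ 1 - 2ε ≥
  -- c`.
  obtain ⟨ε, hε0, hε1, hεc⟩ : ∃ ε : ℝ, 0 < ε ∧ ε < 1 ∧ c ≤ (1 - ε) * (1 - ε) := by
    refine ⟨min ((1 - c) / 2) (1 / 2), by positivity [sub_pos.2 hc], ?_, ?_⟩
    · exact (min_le_right _ _).trans_lt (by norm_num)
    · have := min_le_left ((1 - c) / 2) (1 / 2)
      nlinarith [sq_nonneg (min ((1 - c) / 2) (1 / 2))]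
  -- Chosen with `η` so that `M δ = ε V / 2` and `M η = ε / 2`.
  set δ : ℝ := ε * V / (2 * M) with hδ
  have hδ0 : 0 < δ := by positivity
  set η : ℝ := ε / (2 * M) with hη
  have hη0 : 0 < η := by positivity
  choose t₀ ht₀ using fun i => m.selectedSum_ell_le hKL A i hδ0 hη0
  have hlog : Tendsto (fun α : ℝ => -Real.log α) (𝓝[>] 0) atTop :=
    tendsto_neg_atBot_atTop.comp Real.tendsto_log_nhdsGT_zero
  have e1 : ∀ᶠ α : ℝ in 𝓝[>] 0, ∀ i, (t₀ i : ℝ) ≤ (1 - ε) * -Real.log α / V := by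
    refine eventually_all.2 fun i => ?_
    have : Tendsto (fun α : ℝ => (1 - ε) * -Real.log α / V) (𝓝[>] 0) atTop :=
      (hlog.const_mul_atTop (sub_pos.2 hε1)).atTop_div_const hV
    exact this.eventually_ge_atTop _
  have e2 : ∀ᶠ α : ℝ in 𝓝[>] 0, 2 ^ M * Real.exp (-(ε / 2 * -Real.log α)) ≤ ε / 2 := by
    have : Tendsto (fun α : ℝ => 2 ^ M * Real.exp (-(ε / 2 * -Real.log α))) (𝓝[>] 0)
        (𝓝 (2 ^ M * 0)) :=
      (Real.tendsto_exp_neg_atTop_nhds_zero.comp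
        (hlog.const_mul_atTop (half_pos hε0))).const_mul _
    rw [mul_zero] at this
    exact this.eventually_le_const (half_pos hε0)
  filter_upwards [e1, e2, hlog.eventually_ge_atTop 0, self_mem_nhdsWithin] with α h1 h2 h3 h4
  have hα : 0 < α := h4
  set l := -Real.log α with hl
  have habs : |Real.log α| = l := by rw [abs_of_nonpos (by linarith)]
  rw [habs]
  set t := ⌊(1 - ε) * l / V⌋₊ with ht
  have hx : 0 ≤ (1 - ε) * l / V := div_nonneg (mul_nonneg (sub_pos.2 hε1).le h3) hV.le
  have htle : (t : ℝ) ≤ (1 - ε) * l / V := Nat.floor_le hx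
  have htlt : (1 - ε) * l / V < t + 1 := Nat.lt_floor_add_one _
  refine le_iInf₂ fun p hp => (ENNReal.ofReal_le_ofReal ?_).trans (p.le_lintegral_T A t)
  -- The level `a = (1 - ε / 2) l` is allowed since `(1 + ε / 2) (1 - ε) ≤ 1 - ε / 2`; it leaves `e
  -- ^ a * α = α ^ (ε / 2)`.
  have hP : (m.P A).real {ω | p.T ω ≤ t} ≤
      2 ^ M * (Real.exp ((1 - ε / 2) * l) * α) + M * η := by
    refine p.P_T_le_le hKL A hkM hα.le hp hδ0.le hV.le ?_ fun i =>
      ht₀ i t (Nat.le_floor (h1 i)) _ (p.measurableSet_selected i)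
    have hMδ : (M : ℝ) * (δ * t) = ε / 2 * (V * t) := by
      rw [hδ]; field_simp
    have hVt : V * t ≤ (1 - ε) * l := by
      rw [le_div_iff₀ hV] at htle
      linarith
    rw [hMδ]
    nlinarith [mul_le_mul_of_nonneg_left hVt (by positivity : 0 ≤ 1 + ε / 2),
      mul_nonneg (sq_nonneg ε) h3]
  have hexp : Real.exp ((1 - ε / 2) * l) * α = Real.exp (-(ε / 2 * l)) := by
    have : α = Real.exp (-l) := by rw [hl, neg_neg, Real.exp_log hα]
    conv_lhs => rw [this]
    rw [← Real.exp_add]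
    congr 1
    ring
  have hMη : (M : ℝ) * η = ε / 2 := by rw [hη]; field_simp
  rw [hexp, hMη] at hP
  have hq : 1 - ε ≤ 1 - (m.P A).real {ω | p.T ω ≤ t} := by linarith
  calc c * (l / V) ≤ (1 - ε) * (1 - ε) * (l / V) :=
        mul_le_mul_of_nonneg_right hεc (div_nonneg h3 hV.le)
    _ = ((1 - ε) * l / V) * (1 - ε) := by ring
    _ ≤ (t + 1) * (1 - (m.P A).real {ω | p.T ω ≤ t}) :=
        mul_le_mul htlt.le hq (sub_pos.2 hε1).le (by positivity)

end Model

end AnomalyId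

theorem mainTheorem3 {M : ℕ} {S Ω : Type*} [MeasurableSpace S] [MeasurableSpace Ω]
    (m : AnomalyId.Model M S Ω) (hKL : m.KLPosFinite) (hmom : m.LLogLMoment)
    (k : ℕ) (hk : 1 ≤ k) (hkM : k ≤ M) (K : ℝ) (hK : 0 < K) (hKM : K ≤ M)
    (A : Finset (Fin M)) :
    1 ≤ liminf (fun α : ℝ => m.optimalTime A α k K /
        ENNReal.ofReal (|Real.log α| / AnomalyId.maxMinValue k K (m.orderedKL A))) (𝓝[>] 0) := by
  have hV : 0 < AnomalyId.maxMinValue k K (m.orderedKL A) :=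
    AnomalyId.maxMinValue_pos hk hkM hK hKM fun i => AnomalyId.Model.klNumber_pos hKL A _
  have hlog : Tendsto (fun α : ℝ => -Real.log α) (𝓝[>] 0) atTop :=
    tendsto_neg_atBot_atTop.comp Real.tendsto_log_nhdsGT_zero
  refine le_of_forall_lt_imp_le_of_dense fun c hc => le_liminf_of_le (by isBoundedDefault) ?_
  have hct : c ≠ ∞ := hc.ne_top
  have hc1 : c.toReal < 1 := by
    simpa using (ENNReal.toReal_lt_toReal hct ENNReal.one_ne_top).2 hc
  filter_upwards [AnomalyId.Model.eventually_le_optimalTime hKL hk hkM A hV hc1,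
    hlog.eventually_gt_atTop 0] with α h1 h2
  have hpos : 0 < |Real.log α| / AnomalyId.maxMinValue k K (m.orderedKL A) :=
    div_pos (abs_pos.2 (by linarith)) hV
  rw [ENNReal.le_div_iff_mul_le (Or.inl (by simpa using hpos)) (Or.inl ENNReal.ofReal_ne_top)]
  rwa [ENNReal.ofReal_mul ENNReal.toReal_nonneg, ENNReal.ofReal_toReal hct] at h1
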